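/- Let $V:(0,\infty)\to\mathbb C$ be a measurable potential such that $\int_0^\infty e^{ax}|V(x)|\,dx<\infty$ for a certain real $a$, put $$b=\frac1{\ln 2}\int_0^\infty |V(x)|\,dx ,$$ and assume $a\ge b$. Let $L_V=-d^2/dx^2+V(x)$ be the operator in $L_2(0,\infty)$ with Dirichlet boundary condition at zero: its domain consists of the $y\in L_2(0,\infty)$ such that $y,y'$ are locally absolutely continuous on $[0,\infty)$, $y(0)=0$ and $-y''+Vy\in L_2(0,\infty)$. For $\operatorname{Im}k>-a/2$, or $\operatorname{Im}k\ge 0$, let $e(x,k)=e^{ikx}\sum_{n\ge0}\varepsilon^{(n)}(x,k)$, where $\varepsilon^{(0)}=1$ and $$\varepsilon^{(n+1)}(x,k)=\int_x^\infty\frac{e^{2ik(\xi-x)}-1}{2ik}\,V(\xi)\,\varepsilon^{(n)}(\xi,k)\,d\xi$$ (the quotient being $\xi-x$ for $k=0$), be the Jost solution of $-y''+Vy=k^2y$, with $e(x,k)\sim e^{ikx}$ as $x\to\infty$, and let $e(k)=e(0,k)$ be the Jost function. The spectral singularities of $L_V$ are the points $\lambda=k^2$ given by the real zeros $k$ of $e$.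 Let $N(V)$ be the total multiplicity of eigenvalues and spectral singularities of $L_V$, that is, the sum over all eigenvalues $\lambda$ of $L_V$ of the algebraic multiplicity $\dim\bigcup_n\ker(L_V-\lambda)^n$, plus the sum over all real zeros $k$ of the Jost function of the order of the zero. Then $$N(V)\ \le\ 10\left\{1+\frac2b\int_0^\infty e^{bx}|V(x)|\,dx\right\}$$ (in particular $N(V)$ is finite). If $b=0$, i.e. $V=0$ almost everywhere, the term with $2/b$ is read as $0$. -/

import Mathlib

open MeasureTheory Set
open scoped ENNReal

noncomputable section

namespace HalfLineSchrodinger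

/-- The Hilbert space `L²(0, ∞)` of complex-valued functions. -/
abbrev HalfLineL2 : Type := Lp ℂ 2 (volume.restrict (Ioi (0 : ℝ)))

/-- `IsDirichletPair V u f` says that `u` lies in the domain of the Dirichlet operator
`L_V = -d²/dx² + V` on `L²(0, ∞)` and that `L_V u = f`: the class `u` has a representative `y`
which is continuously differentiable on `[0, ∞)`, with `y 0 = 0`, whose derivative `z` is locally
absolutely continuous, and `-y'' + V y = f`. The last two requirements are expressed by saying that
`z` is an indefinite integral of the locally integrable function `V y - f`. -/
def IsDirichletPair (V : ℝ → ℂ) (u f : HalfLineL2) : Prop :=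
  ∃ y z : ℝ → ℂ,
    (∀ᵐ x ∂(volume.restrict (Ioi (0 : ℝ))), u x = y x) ∧
    y 0 = 0 ∧
    (∀ x : ℝ, 0 ≤ x → HasDerivWithinAt y (z x) (Ici 0) x) ∧
    (∀ x : ℝ, 0 ≤ x → IntervalIntegrable (fun t => V t * y t) volume 0 x) ∧
    (∀ x : ℝ, 0 ≤ x → z x = z 0 + ∫ t in (0 : ℝ)..x, (V t * y t - f t))

theorem intervalIntegrable_coe (f : HalfLineL2) (x : ℝ) (hx : 0 ≤ x) :
    IntervalIntegrable (fun t => f t) volume 0 x := by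
  rw [intervalIntegrable_iff_integrableOn_Ioc_of_le hx]
  have h : MemLp (fun t => f t) 2 (volume.restrict (Ioc 0 x)) :=
    (Lp.memLp f).mono_measure (Measure.restrict_mono Ioc_subset_Ioi_self le_rfl)
  exact h.integrable (by norm_num)

theorem integral_congr_halfLine {f g : ℝ → ℂ}
    (h : ∀ᵐ t ∂(volume.restrict (Ioi (0 : ℝ))), f t = g t) (x : ℝ) (hx : 0 ≤ x) :
    ∫ t in (0 : ℝ)..x, f t = ∫ t in (0 : ℝ)..x, g t := by
  rw [intervalIntegral.integral_of_le hx, intervalIntegral.integral_of_le hx]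
  exact integral_congr_ae
    (ae_mono (Measure.restrict_mono Ioc_subset_Ioi_self le_rfl) h)

/-- The graph of `L_V`, a linear subspace of `L²(0, ∞) × L²(0, ∞)`. -/
def dirichletGraph (V : ℝ → ℂ) : Submodule ℂ (HalfLineL2 × HalfLineL2) where
  carrier := {p | IsDirichletPair V p.1 p.2}
  zero_mem' := by
    refine ⟨fun _ => 0, fun _ => 0, Lp.coeFn_zero _ _ _, rfl,
      fun x _ => hasDerivWithinAt_const _ _ _, fun x _ => by simp, fun x hx => ?_⟩
    have h : ∀ᵐ t ∂(volume.restrict (Ioi (0 : ℝ))),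
        V t * 0 - ((0 : HalfLineL2) : ℝ → ℂ) t = (fun _ => (0 : ℂ)) t := by
      filter_upwards [Lp.coeFn_zero ℂ 2 (volume.restrict (Ioi (0 : ℝ)))] with t ht
      rw [ht]; simp
    have := integral_congr_halfLine h x hx
    simpa using this.symm
  add_mem' := by
    rintro ⟨u₁, f₁⟩ ⟨u₂, f₂⟩ ⟨y₁, z₁, hu₁, h0₁, hd₁, hi₁, hz₁⟩ ⟨y₂, z₂, hu₂, h0₂, hd₂, hi₂, hz₂⟩
    refine ⟨fun x => y₁ x + y₂ x, fun x => z₁ x + z₂ x, ?_, by simp [h0₁, h0₂],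
      fun x hx => (hd₁ x hx).add (hd₂ x hx), fun x hx => ?_, fun x hx => ?_⟩
    · filter_upwards [Lp.coeFn_add u₁ u₂, hu₁, hu₂] with t ht h1 h2
      exact ht.trans (congrArg₂ (· + ·) h1 h2)
    · simpa [mul_add] using (hi₁ x hx).add (hi₂ x hx)
    · have h : ∀ᵐ t ∂(volume.restrict (Ioi (0 : ℝ))),
          V t * (y₁ t + y₂ t) - ((f₁ + f₂ : HalfLineL2) : ℝ → ℂ) t
            = (V t * y₁ t - f₁ t) + (V t * y₂ t - f₂ t) := by
        filter_upwards [Lp.coeFn_add f₁ f₂] with t ht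
        rw [ht, Pi.add_apply]; ring
      have h' := integral_congr_halfLine h x hx
      rw [intervalIntegral.integral_add
        ((hi₁ x hx).sub (intervalIntegrable_coe f₁ x hx))
        ((hi₂ x hx).sub (intervalIntegrable_coe f₂ x hx))] at h'
      simp only [Prod.mk_add_mk]
      rw [h', hz₁ x hx, hz₂ x hx]; ring
  smul_mem' := by
    rintro c ⟨u, f⟩ ⟨y, z, hu, h0, hd, hi, hz⟩
    refine ⟨fun x => c * y x, fun x => c * z x, ?_, by simp [h0],
      fun x hx => (hd x hx).const_mul c, fun x hx => ?_, fun x hx => ?_⟩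
    · filter_upwards [Lp.coeFn_smul c u, hu] with t ht h1
      simp [ht, h1]
    · simpa [mul_left_comm] using (hi x hx).const_mul c
    · have h : ∀ᵐ t ∂(volume.restrict (Ioi (0 : ℝ))),
          V t * (c * y t) - ((c • f : HalfLineL2) : ℝ → ℂ) t = c * (V t * y t - f t) := by
        filter_upwards [Lp.coeFn_smul c f] with t ht
        simp [ht]; ring
      have h' := integral_congr_halfLine h x hx
      rw [intervalIntegral.integral_const_mul] at h'
      simp only [Prod.smul_mk]
      rw [h', hz x hx]; ring

/-- The graph is single-valued. -/
theorem dirichletGraph_functional (V : ℝ → ℂ) (p : HalfLineL2 × HalfLineL2)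
    (hp : p ∈ dirichletGraph V) (h1 : p.1 = 0) : p.2 = 0 := by
  obtain ⟨u, f⟩ := p
  obtain ⟨y, z, hu, h0, hd, hi, hz⟩ := hp
  simp only at h1 hu hz ⊢
  subst h1
  have hy0 : y =ᵐ[volume.restrict (Ioi (0 : ℝ))] fun _ => (0 : ℂ) := by
    filter_upwards [hu, Lp.coeFn_zero ℂ 2 (volume.restrict (Ioi (0 : ℝ)))] with t h1 h2
    rw [← h1, h2]; rfl
  have hyc : ContinuousOn y (Ioi 0) := fun x hx =>
    ((hd x (le_of_lt hx)).continuousWithinAt).mono Ioi_subset_Ici_self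
  have hy : ∀ x, 0 ≤ x → y x = 0 := by
    intro x hx
    rcases hx.eq_or_lt with rfl | hx
    · exact h0
    · exact Measure.eqOn_open_of_ae_eq hy0 isOpen_Ioi hyc continuousOn_const hx
  have hzz : ∀ x, 0 ≤ x → z x = 0 := by
    intro x hx
    have h2 : HasDerivWithinAt y 0 (Ici 0) x :=
      (hasDerivWithinAt_const x (Ici (0 : ℝ)) (0 : ℂ)).congr (fun t ht => hy t ht) (hy x hx)
    exact (uniqueDiffOn_Ici (0 : ℝ) x hx).eq_deriv _ (hd x hx) h2
  have hint : ∀ x, 0 ≤ x → ∫ t in (0 : ℝ)..x, f t = 0 := by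
    intro x hx
    have h := hz x hx
    rw [hzz x hx, hzz 0 le_rfl, zero_add] at h
    have h' : ∀ᵐ t ∂(volume.restrict (Ioi (0 : ℝ))), V t * y t - f t = - f t := by
      filter_upwards [hy0] with t ht
      simp [ht]
    rw [integral_congr_halfLine h' x hx, intervalIntegral.integral_neg] at h
    exact neg_eq_zero.mp h.symm
  have hG : LocallyIntegrable ((Ioi (0 : ℝ)).indicator (fun t => f t)) volume := by
    have h2 : MemLp ((Ioi (0 : ℝ)).indicator (fun t => f t)) 2 volume :=
      (memLp_indicator_iff_restrict measurableSet_Ioi).2 (Lp.memLp f)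
    exact h2.locallyIntegrable (by norm_num)
  have hder := LocallyIntegrable.ae_hasDerivAt_integral hG
  have hfin : ∀ᵐ t ∂(volume.restrict (Ioi (0 : ℝ))), f t = 0 := by
    rw [ae_restrict_iff' measurableSet_Ioi]
    filter_upwards [hder] with t ht hpos
    have h3 := ht 0
    have h4 : HasDerivAt (fun x => ∫ s in (0 : ℝ)..x, (Ioi (0 : ℝ)).indicator (fun t => f t) s)
        0 t := by
      refine (hasDerivAt_const t (0 : ℂ)).congr_of_eventuallyEq ?_
      filter_upwards [Ioi_mem_nhds hpos] with x hx
      have hx' : (0 : ℝ) ≤ x := le_of_lt hx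
      rw [← hint x hx']
      refine integral_congr_halfLine ?_ x hx'
      filter_upwards [ae_restrict_mem measurableSet_Ioi] with s hs
      simp only [indicator_of_mem hs]
    have h5 := h3.unique h4
    rwa [indicator_of_mem hpos] at h5
  exact (Lp.eq_zero_iff_ae_eq_zero).2 hfin

/-- The (unbounded) operator `L_V = -d²/dx² + V` on `L²(0, ∞)` with Dirichlet condition at zero. -/
def schrodingerOperator (V : ℝ → ℂ) : HalfLineL2 →ₗ.[ℂ] HalfLineL2 :=
  (dirichletGraph V).toLinearPMap

theorem schrodingerOperator_graph (V : ℝ → ℂ) :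
    (schrodingerOperator V).graph = dirichletGraph V :=
  Submodule.toLinearPMap_graph_eq _ (dirichletGraph_functional V)

/-- `ker (T - μ)^n` for an unbounded operator `T`. -/
def powKer {H : Type*} [AddCommGroup H] [Module ℂ H] (T : H →ₗ.[ℂ] H) (μ : ℂ) :
    ℕ → Submodule ℂ H
  | 0 => ⊥
  | n + 1 => ((powKer T μ n).comap (T.toFun - μ • T.domain.subtype)).map T.domain.subtype

/-- The root subspace `⋃ₙ ker (T - μ)^n`. -/
def rootSpace {H : Type*} [AddCommGroup H] [Module ℂ H] (T : H →ₗ.[ℂ] H) (μ : ℂ) :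
    Submodule ℂ H :=
  ⨆ n : ℕ, powKer T μ n

/-- The algebraic multiplicity of `μ` as an eigenvalue of `T`: the dimension of the root subspace
(`0` exactly when `μ` is not an eigenvalue, `⊤` for an infinite-dimensional root subspace). -/
def algMultiplicity {H : Type*} [AddCommGroup H] [Module ℂ H] (T : H →ₗ.[ℂ] H) (μ : ℂ) : ℕ∞ :=
  Cardinal.toENat (Module.rank ℂ (rootSpace T μ))

/-- `(e^{2ikt} - 1) / (2ik)`, with its limit value `t` at `k = 0`. -/
def jostKernel (k : ℂ) (t : ℝ) : ℂ :=
  if k = 0 then (t : ℂ) else (Complex.exp (2 * Complex.I * k * t) - 1) / (2 * Complex.I * k)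

/-- The successive approximations `ε⁽ⁿ⁾(x, k)`. -/
def jostIterate (V : ℝ → ℂ) (k : ℂ) : ℕ → ℝ → ℂ
  | 0 => fun _ => 1
  | n + 1 => fun x => ∫ ξ in Ioi x, jostKernel k (ξ - x) * V ξ * jostIterate V k n ξ

/-- The Jost solution `e(x, k) = e^{ikx} ∑ₙ ε⁽ⁿ⁾(x, k)` of `-y'' + V y = k² y`, which is asymptotic
to `e^{ikx}` as `x → ∞`; if `∫ e^{ax} |V| < ∞`, this is meaningful for `Im k > -a/2`. -/
def jostSolution (V : ℝ → ℂ) (x : ℝ) (k : ℂ) : ℂ :=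
  Complex.exp (Complex.I * k * x) * ∑' n : ℕ, jostIterate V k n x

/-- The Jost function `e(k) = e(0, k)`. -/
def jostFunction (V : ℝ → ℂ) (k : ℂ) : ℂ := jostSolution V 0 k

/-- `N(V)`: the total number of eigenvalues of `L_V`, counted with algebraic multiplicity, and of
spectral singularities `k²`, which are given by the real zeros `k` of the Jost function, counted
with the order of the zero. -/
def totalMultiplicity (V : ℝ → ℂ) : ℝ≥0∞ :=
  (∑' μ : ℂ, (algMultiplicity (schrodingerOperator V) μ : ℝ≥0∞)) +
    ∑' k : ℝ, (analyticOrderAt (jostFunction V) (k : ℂ) : ℝ≥0∞)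

end HalfLineSchrodinger

end

namespace HalfLineSchrodinger

open Filter Topology

/-! The bound counts zeros of the Jost function `e(k)` in the closed upper half-plane by Jensen's
inequality.

Multiplicities. For `Im k > 0` put `Φ_u(k) = ∫ u e(·, k)`. If `f = L_V u`, Green's identity
(`ExpDecay.exists_green`) gives `Φ_f = u'(0) e(k) + k² Φ_u`; its boundary term at infinity vanishes
by `wronskian_limit_eq_zero`. Applied along a chain of root vectors at `μ`, it gives `(k² - μ)^n
Φ_u(k) = e(k) p(k²)` for a root vector `u` of height `n`, where `-p(μ)` is the derivative at zero of
the eigenfunction at the bottom of the chain, hence nonzero (`ExpDecay.exists_factor`). As `Φ_u` is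
locally bounded, `e` vanishes to order at least `n` at the root `k` of `μ` with `Im k > 0`.
Eigenspaces are at most one-dimensional, so algebraic multiplicity is at most the order of the zero
(`ExpDecay.algMultiplicity_le`). Points of `[0, ∞)` are never eigenvalues
(`ExpDecay.eq_zero_of_real`), so real zeros are counted once, as spectral singularities.

Counting. The series for `e(x, k)` is dominated by an exponential series: if the kernel is at most
`κ e^{τt}`, the sum is at most `exp(κ ∫ e^{τt}|V|)` (`KernelBound.jostIterate_spec`). With `κ =
1/|k|` and `τ = 0`, `|e(k) - 1| < 1` for `|k| > b`, `Im k ≥ 0`, so all relevant zeros lie in the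
half-disc `|k| ≤ b`. This half-disc lies in the disc of radius `√5 b` about `2ib`, where `|e(2ib)| ≥
1/2`. On the circle of radius `2.49 b` about the same centre, `τ = b` is admissible and `|k| ≥ 0.49
b`, so `|e| ≤ exp(∫ e^{bx}|V| / (0.49 b))`. Jensen's inequality for these two radii yields the
constants 10 and 2 (`ExpDecay.tsum_upperOrder_le`). -/

/-- `F` is, on `[0, ∞)`, an indefinite integral of the locally integrable function `f`. -/
def IsPrimitive {𝕜 : Type*} [RCLike 𝕜] (F f : ℝ → 𝕜) : Prop :=
  ∀ x : ℝ, 0 ≤ x → IntervalIntegrable f volume 0 x ∧ F x = F 0 + ∫ t in (0 : ℝ)..x, f t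

/-! ### Calculus of indefinite integrals on the half-line -/

section Primitive

variable {𝕜 : Type*} [RCLike 𝕜] {F G f g : ℝ → 𝕜}

/-- Fubini on the square, cut along its diagonal. This is integration by parts for merely integrable
densities, with no pointwise derivative needed. -/
theorem integral_mul_integral_Ioc {b : ℝ} (hf : IntegrableOn f (Ioc 0 b))
    (hg : IntegrableOn g (Ioc 0 b)) :
    (∫ t in Ioc 0 b, f t) * (∫ t in Ioc 0 b, g t) =
      (∫ t in Ioc 0 b, f t * ∫ s in Ioc 0 t, g s) + ∫ t in Ioc 0 b, (∫ s in Ioc 0 t, f s) * g t := by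
  set μ : Measure ℝ := volume.restrict (Ioc 0 b)
  have hint : Integrable (fun z : ℝ × ℝ => f z.1 * g z.2) (μ.prod μ) := hf.mul_prod hg
  have hS : MeasurableSet {z : ℝ × ℝ | z.1 ≤ z.2} := measurableSet_le measurable_fst measurable_snd
  rw [← integral_prod_mul, ← integral_add_compl hS hint, ← integral_indicator hS,
    ← integral_indicator hS.compl, integral_prod_symm _ (hint.indicator hS),
    integral_prod _ (hint.indicator hS.compl), add_comm]
  congr 1
  · refine setIntegral_congr_fun measurableSet_Ioc fun s hs => ?_
    have h1 : ∀ t, {z : ℝ × ℝ | z.1 ≤ z.2}ᶜ.indicator (fun z : ℝ × ℝ => f z.1 * g z.2) (s, t)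
        = f s * (Iio s).indicator g t := by
      intro t
      by_cases h : t < s
      · simp [indicator, h]
      · simp [indicator, h]
    simp only [h1]
    rw [integral_const_mul, integral_indicator measurableSet_Iio,
      Measure.restrict_restrict measurableSet_Iio, integral_Ioc_eq_integral_Ioo]
    congr 3
    ext t
    simp only [mem_inter_iff, mem_Iio, mem_Ioc, mem_Ioo] at hs ⊢
    constructor
    · rintro ⟨h1, h2, h3⟩; exact ⟨h2, h1⟩
    · rintro ⟨h1, h2⟩; exact ⟨h2, h1, by linarith⟩
  · refine setIntegral_congr_fun measurableSet_Ioc fun t ht => ?_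
    have h1 : ∀ s, {z : ℝ × ℝ | z.1 ≤ z.2}.indicator (fun z : ℝ × ℝ => f z.1 * g z.2) (s, t)
        = (Iic t).indicator f s * g t := by
      intro s
      by_cases h : s ≤ t
      · simp [indicator, h]
      · simp [indicator, h]
    simp only [h1]
    rw [integral_mul_const, integral_indicator measurableSet_Iic,
      Measure.restrict_restrict measurableSet_Iic]
    congr 3
    ext s
    simp only [mem_inter_iff, mem_Iic, mem_Ioc] at ht ⊢
    constructor
    · rintro ⟨h1, h2, h3⟩; exact ⟨h2, h1⟩
    · rintro ⟨h1, h2⟩; exact ⟨h2, h1, by linarith⟩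

theorem IsPrimitive.integrableOn_Ioc (hF : IsPrimitive F f) {x : ℝ} (hx : 0 ≤ x) :
    IntegrableOn f (Ioc 0 x) :=
  (intervalIntegrable_iff_integrableOn_Ioc_of_le hx).1 (hF x hx).1

theorem IsPrimitive.eq_Ioc (hF : IsPrimitive F f) {x : ℝ} (hx : 0 ≤ x) :
    F x = F 0 + ∫ t in Ioc 0 x, f t := by
  rw [← intervalIntegral.integral_of_le hx]; exact (hF x hx).2

theorem IsPrimitive.intervalIntegrable (hF : IsPrimitive F f) {x y : ℝ} (hx : 0 ≤ x)
    (hy : 0 ≤ y) : IntervalIntegrable f volume x y :=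
  (hF x hx).1.symm.trans (hF y hy).1

theorem IsPrimitive.sub_eq (hF : IsPrimitive F f) {x y : ℝ} (hx : 0 ≤ x) (hy : 0 ≤ y) :
    F y - F x = ∫ t in x..y, f t := by
  rw [(hF x hx).2, (hF y hy).2, ← intervalIntegral.integral_interval_sub_left (hF y hy).1 (hF x hx).1]
  ring

theorem IsPrimitive.continuousOn (hF : IsPrimitive F f) : ContinuousOn F (Ici 0) := by
  intro x hx
  have hx0 : (0 : ℝ) ≤ x := hx
  have h1 : ContinuousOn (fun y => ∫ t in (0 : ℝ)..y, f t) (uIcc 0 (x + 1)) :=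
    intervalIntegral.continuousOn_primitive_interval'
      (hF (x + 1) (by linarith)).1 left_mem_uIcc
  rw [uIcc_of_le (by linarith)] at h1
  have h2 : ContinuousWithinAt (fun y => F 0 + ∫ t in (0 : ℝ)..y, f t) (Icc 0 (x + 1)) x :=
    continuousWithinAt_const.add (h1 x ⟨hx0, by linarith⟩)
  have h3 : ContinuousWithinAt F (Icc 0 (x + 1)) x :=
    h2.congr (fun y hy => (hF y hy.1).2) (hF x hx0).2
  refine h3.mono_of_mem_nhdsWithin ?_
  rw [← Ici_inter_Iic]
  exact inter_mem_nhdsWithin _ (Iic_mem_nhds (by linarith))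

theorem IsPrimitive.const_mul (hF : IsPrimitive F f) (c : 𝕜) :
    IsPrimitive (fun x => c * F x) (fun x => c * f x) := fun x hx =>
  ⟨(hF x hx).1.const_mul c, by
    simp only [intervalIntegral.integral_const_mul, (hF x hx).2]; ring⟩

theorem IsPrimitive.add (hF : IsPrimitive F f) (hG : IsPrimitive G g) :
    IsPrimitive (fun x => F x + G x) (fun x => f x + g x) := fun x hx =>
  ⟨(hF x hx).1.add (hG x hx).1, by
    simp only
    rw [intervalIntegral.integral_add (hF x hx).1 (hG x hx).1, (hF x hx).2, (hG x hx).2]; ring⟩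

theorem IsPrimitive.sub (hF : IsPrimitive F f) (hG : IsPrimitive G g) :
    IsPrimitive (fun x => F x - G x) (fun x => f x - g x) := by
  simpa [sub_eq_add_neg] using hF.add (hG.const_mul (-1))

theorem IsPrimitive.congr (hF : IsPrimitive F f)
    (h : ∀ᵐ t ∂(volume.restrict (Ioi (0 : ℝ))), f t = g t) : IsPrimitive F g := by
  intro x hx
  have h' : ∀ᵐ t ∂(volume.restrict (Ioc (0 : ℝ) x)), f t = g t :=
    ae_mono (Measure.restrict_mono Ioc_subset_Ioi_self le_rfl) h
  refine ⟨?_, ?_⟩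
  · rw [intervalIntegrable_iff_integrableOn_Ioc_of_le hx]
    exact (hF.integrableOn_Ioc hx).congr h'
  · rw [hF.eq_Ioc hx, intervalIntegral.integral_of_le hx]
    exact congrArg _ (integral_congr_ae h')

theorem IsPrimitive.mul (hF : IsPrimitive F f) (hG : IsPrimitive G g) :
    IsPrimitive (fun x => F x * G x) (fun x => f x * G x + F x * g x) := by
  intro x hx
  have hf := hF.integrableOn_Ioc hx
  have hg := hG.integrableOn_Ioc hx
  have hfi := (hF x hx).1
  have hgi := (hG x hx).1
  have hFc : ContinuousOn F (uIcc 0 x) :=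
    hF.continuousOn.mono (by rw [uIcc_of_le hx]; exact Icc_subset_Ici_self)
  have hGc : ContinuousOn G (uIcc 0 x) :=
    hG.continuousOn.mono (by rw [uIcc_of_le hx]; exact Icc_subset_Ici_self)
  have i1 : IntervalIntegrable (fun t => f t * G t) volume 0 x := hfi.mul_continuousOn hGc
  have i2 : IntervalIntegrable (fun t => F t * g t) volume 0 x := hgi.continuousOn_mul hFc
  refine ⟨i1.add i2, ?_⟩
  simp only
  rw [intervalIntegral.integral_add i1 i2]
  have e1 : ∫ t in (0 : ℝ)..x, f t * G t
      = (∫ t in Ioc 0 x, f t) * G 0 + ∫ t in Ioc 0 x, f t * ∫ s in Ioc 0 t, g s := by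
    have : ∀ t ∈ Ioc 0 x, f t * ∫ s in Ioc 0 t, g s = f t * G t - f t * G 0 := by
      intro t ht
      rw [hG.eq_Ioc ht.1.le]; ring
    rw [setIntegral_congr_fun measurableSet_Ioc this, integral_sub, integral_mul_const,
      intervalIntegral.integral_of_le hx]
    · ring
    · exact (intervalIntegrable_iff_integrableOn_Ioc_of_le hx).1 i1
    · exact hf.mul_const _
  have e2 : ∫ t in (0 : ℝ)..x, F t * g t
      = F 0 * (∫ t in Ioc 0 x, g t) + ∫ t in Ioc 0 x, (∫ s in Ioc 0 t, f s) * g t := by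
    have : ∀ t ∈ Ioc 0 x, (∫ s in Ioc 0 t, f s) * g t = F t * g t - F 0 * g t := by
      intro t ht
      rw [hF.eq_Ioc ht.1.le]; ring
    rw [setIntegral_congr_fun measurableSet_Ioc this, integral_sub, integral_const_mul,
      intervalIntegral.integral_of_le hx]
    · ring
    · exact (intervalIntegrable_iff_integrableOn_Ioc_of_le hx).1 i2
    · exact hg.const_mul _
  have key := integral_mul_integral_Ioc hf hg
  rw [e1, e2, hF.eq_Ioc hx, hG.eq_Ioc hx]
  linear_combination key

theorem IsPrimitive.pow (hF : IsPrimitive F f) (n : ℕ) :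
    IsPrimitive (fun x => F x ^ (n + 1)) (fun x => (n + 1) * (f x * F x ^ n)) := by
  induction n with
  | zero => simpa using hF
  | succ n ih =>
    have h := ih.mul hF
    have e1 : (fun x => F x ^ (n + 1) * F x) = fun x => F x ^ (n + 1 + 1) := by
      ext x; ring
    rw [e1] at h
    convert h using 1
    ext x
    push_cast
    ring

theorem isPrimitive_of_hasDerivWithinAt (h : ∀ x, 0 ≤ x → HasDerivWithinAt F (f x) (Ici 0) x)
    (hf : ContinuousOn f (Ici 0)) : IsPrimitive F f := by
  intro x hx
  have hfi : IntervalIntegrable f volume 0 x := by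
    refine ContinuousOn.intervalIntegrable (hf.mono ?_)
    rw [uIcc_of_le hx]; exact Icc_subset_Ici_self
  refine ⟨hfi, ?_⟩
  rw [intervalIntegral.integral_eq_sub_of_hasDeriv_right_of_le hx
    (fun t ht => ((h t ht.1).continuousWithinAt).mono Icc_subset_Ici_self)
    (fun t ht => (h t ht.1.le).mono (Ioi_subset_Ici ht.1.le)) hfi]
  ring

end Primitive

/-! ### Tail integrals and uniqueness for the Cauchy problem -/

/-- The tail integral of an integrable function is a primitive of its negative. -/
theorem isPrimitive_tail {𝕜 : Type*} [RCLike 𝕜] {g : ℝ → 𝕜} (hg : IntegrableOn g (Ioi 0)) :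
    IsPrimitive (fun x => ∫ t in Ioi x, g t) (fun x => -g x) := by
  intro x hx
  refine ⟨?_, ?_⟩
  · rw [intervalIntegrable_iff_integrableOn_Ioc_of_le hx]
    exact (hg.mono_set Ioc_subset_Ioi_self).neg
  · simp only [intervalIntegral.integral_neg]
    rw [intervalIntegral.integral_of_le hx, ← Ioc_union_Ioi_eq_Ioi hx,
      setIntegral_union (Ioc_disjoint_Ioi le_rfl) measurableSet_Ioi
        (hg.mono_set Ioc_subset_Ioi_self) (hg.mono_set (Ioi_subset_Ioi hx))]
    ring

/-- Tail integrals of an integrable function tend to zero. -/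
theorem tendsto_tail {𝕜 : Type*} [RCLike 𝕜] {g : ℝ → 𝕜} (hg : IntegrableOn g (Ioi 0)) :
    Tendsto (fun y => ∫ s in Ioi y, g s) atTop (𝓝 0) := by
  have h2 := intervalIntegral_tendsto_integral_Ioi 0 hg tendsto_id
  have h3 : Tendsto (fun y => (∫ s in Ioi (0 : ℝ), g s) - ∫ s in (0 : ℝ)..y, g s) atTop
      (𝓝 ((∫ s in Ioi (0 : ℝ), g s) - ∫ s in Ioi (0 : ℝ), g s)) := tendsto_const_nhds.sub h2
  rw [sub_self] at h3
  refine h3.congr' ?_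
  filter_upwards [eventually_ge_atTop 0] with y hy
  have h5 := (isPrimitive_tail hg y hy).2
  simp only [intervalIntegral.integral_neg] at h5
  rw [h5]; ring

/-- With `J` the tail integral of `g`, the integrand is `-(J^(n+1))' / (n+1)`, and `J` tends to zero
at infinity. This produces the factorials in the estimate of the successive approximations. -/
theorem integral_tail_pow {g : ℝ → ℝ} (hg : IntegrableOn g (Ioi 0)) (n : ℕ) {x : ℝ} (hx : 0 ≤ x) :
    IntegrableOn (fun t => g t * (∫ s in Ioi t, g s) ^ n) (Ioi 0) ∧
    ∫ t in Ioi x, g t * (∫ s in Ioi t, g s) ^ n = (∫ s in Ioi x, g s) ^ (n + 1) / (n + 1) := by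
  have hJ := isPrimitive_tail hg
  have hJc := hJ.continuousOn
  have hbound : ∀ t ∈ Ioi (0 : ℝ), ‖(∫ s in Ioi t, g s) ^ n‖ ≤ (∫ s in Ioi (0 : ℝ), ‖g s‖) ^ n := by
    intro t ht
    rw [norm_pow]
    gcongr
    refine (norm_integral_le_integral_norm _).trans ?_
    exact setIntegral_mono_set hg.norm (ae_of_all _ fun _ => norm_nonneg _)
      (Ioi_subset_Ioi (le_of_lt ht)).eventuallyLE
  have hint : IntegrableOn (fun t => g t * (∫ s in Ioi t, g s) ^ n) (Ioi 0) := by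
    refine Integrable.mul_bdd (c := (∫ s in Ioi (0 : ℝ), ‖g s‖) ^ n) hg ?_ ?_
    · exact ((hJc.mono Ioi_subset_Ici_self).pow n).aestronglyMeasurable measurableSet_Ioi
    · exact (ae_restrict_iff' measurableSet_Ioi).2 (ae_of_all _ hbound)
  refine ⟨hint, ?_⟩
  have h1 := intervalIntegral_tendsto_integral_Ioi x (hint.mono_set (Ioi_subset_Ioi hx)) tendsto_id
  have htail := tendsto_tail hg
  have h4 : Tendsto (fun y => ((∫ s in Ioi x, g s) ^ (n + 1) - (∫ s in Ioi y, g s) ^ (n + 1)) / (n + 1))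
      atTop (𝓝 (((∫ s in Ioi x, g s) ^ (n + 1) - 0 ^ (n + 1)) / (n + 1))) :=
    (tendsto_const_nhds.sub (htail.pow (n + 1))).div_const _
  rw [zero_pow (Nat.succ_ne_zero n), sub_zero] at h4
  refine tendsto_nhds_unique h1 (h4.congr' ?_)
  filter_upwards [eventually_ge_atTop x] with y hy
  have h5 := (hJ.pow n).sub_eq hx (hx.trans hy)
  have hn : ((n : ℝ) + 1) ≠ 0 := by positivity
  rw [div_eq_iff hn, ← neg_sub, h5]
  simp only [neg_mul, mul_neg, intervalIntegral.integral_neg, intervalIntegral.integral_const_mul, id]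
  ring

/-- A nonnegative bounded function dominated by its own Volterra integral vanishes. -/
theorem eq_zero_of_le_integral {φ w G : ℝ → ℝ} {X : ℝ} (hG : IsPrimitive G w) (hG0 : G 0 = 0)
    (hw : ∀ t, 0 ≤ w t) (hφ0 : ∀ x ∈ Icc 0 X, 0 ≤ φ x) (hφ : ContinuousOn φ (Icc 0 X))
    (h : ∀ x ∈ Icc 0 X, φ x ≤ ∫ t in (0 : ℝ)..x, w t * φ t) : ∀ x ∈ Icc 0 X, φ x = 0 := by
  obtain ⟨C, hC⟩ := isCompact_Icc.exists_bound_of_continuousOn hφ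
  -- Feeding the bound back into the Volterra inequality gains a factor `G / (n + 1)` each time, and
  -- `G^n / n!` tends to zero.
  have key : ∀ n : ℕ, ∀ x ∈ Icc 0 X, φ x ≤ C * (G x ^ n / n.factorial) := by
    intro n
    induction n with
    | zero => intro x hx; simpa using (le_abs_self _).trans (hC x hx)
    | succ n ih =>
      intro x hx
      refine (h x hx).trans ?_
      have hGn := hG.pow n
      have hi : IntervalIntegrable (fun t => C / n.factorial / (n + 1) * ((n + 1) * (w t * G t ^ n)))
          volume 0 x := (hGn x hx.1).1.const_mul _
      have hφi : IntervalIntegrable (fun t => w t * φ t) volume 0 x := by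
        refine (hG x hx.1).1.mul_continuousOn (hφ.mono ?_)
        rw [uIcc_of_le hx.1]; exact Icc_subset_Icc_right hx.2
      have hle : ∫ t in (0 : ℝ)..x, w t * φ t ≤
          ∫ t in (0 : ℝ)..x, C / n.factorial / (n + 1) * ((n + 1) * (w t * G t ^ n)) := by
        refine intervalIntegral.integral_mono_on hx.1 hφi hi fun t ht => ?_
        have h1 := mul_le_mul_of_nonneg_left (ih t ⟨ht.1, ht.2.trans hx.2⟩) (hw t)
        refine h1.trans (le_of_eq ?_)
        field_simp
      refine hle.trans (le_of_eq ?_)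
      rw [intervalIntegral.integral_const_mul, ← zero_add (∫ t in (0 : ℝ)..x, _)]
      have h2 := (hGn x hx.1).2
      beta_reduce at h2
      rw [hG0, zero_pow (Nat.succ_ne_zero n)] at h2
      rw [← h2, Nat.factorial_succ]
      push_cast
      field_simp
  intro x hx
  refine le_antisymm ?_ (hφ0 x hx)
  have h1 : Tendsto (fun n : ℕ => C * (G x ^ n / n.factorial)) atTop (𝓝 (C * 0)) :=
    (FloorSemiring.tendsto_pow_div_factorial_atTop (G x)).const_mul C
  rw [mul_zero] at h1
  exact ge_of_tendsto' h1 fun n => key n x hx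

/-- Uniqueness for the Cauchy problem of a second order linear equation with locally integrable
coefficient `q`. -/
theorem eq_zero_of_cauchy {y z q : ℝ → ℂ} (hq : ∀ x, 0 ≤ x → IntervalIntegrable q volume 0 x)
    (hy : IsPrimitive y z) (hz : IsPrimitive z (fun t => q t * y t)) (hy0 : y 0 = 0)
    (hz0 : z 0 = 0) {x : ℝ} (hx : 0 ≤ x) : y x = 0 := by
  -- The system `y' = z`, `z' = q y` has coefficients bounded by `w`, so `|y| + |z|` is dominated by
  -- its own Volterra integral.
  set w : ℝ → ℝ := fun t => 1 + ‖q t‖ with hw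
  have hwi : ∀ x, 0 ≤ x → IntervalIntegrable w volume 0 x := fun x hx =>
    intervalIntegrable_const.add (hq x hx).norm
  have hG : IsPrimitive (fun x => ∫ t in (0 : ℝ)..x, w t) w := fun x hx => ⟨hwi x hx, by simp⟩
  have hyc := hy.continuousOn
  have hzc := hz.continuousOn
  have hφc : ContinuousOn (fun x => ‖y x‖ + ‖z x‖) (Icc 0 x) :=
    (hyc.norm.add hzc.norm).mono Icc_subset_Ici_self
  have := eq_zero_of_le_integral (φ := fun x => ‖y x‖ + ‖z x‖) (X := x) hG (by simp)
    (fun t => by positivity) (fun _ _ => by positivity) hφc ?_ x ⟨hx, le_rfl⟩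
  · have h1 := norm_nonneg (y x)
    have h2 := norm_nonneg (z x)
    exact norm_eq_zero.1 (by linarith)
  · intro t ht
    have i1 := (hy t ht.1).1.norm
    have i2 := (hz t ht.1).1.norm
    have hsub : uIcc 0 t ⊆ Icc 0 x := by rw [uIcc_of_le ht.1]; exact Icc_subset_Icc_right ht.2
    have i3 : IntervalIntegrable (fun s => w s * (‖y s‖ + ‖z s‖)) volume 0 t :=
      (hwi t ht.1).mul_continuousOn (hφc.mono hsub)
    calc ‖y t‖ + ‖z t‖ ≤ (∫ s in (0 : ℝ)..t, ‖z s‖) + ∫ s in (0 : ℝ)..t, ‖q s * y s‖ := by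
          rw [(hy t ht.1).2, (hz t ht.1).2, hy0, hz0, zero_add, zero_add]
          exact add_le_add (intervalIntegral.norm_integral_le_integral_norm ht.1)
            (intervalIntegral.norm_integral_le_integral_norm ht.1)
      _ = ∫ s in (0 : ℝ)..t, (‖z s‖ + ‖q s * y s‖) := (intervalIntegral.integral_add i1 i2).symm
      _ ≤ _ := by
          refine intervalIntegral.integral_mono_on ht.1 (i1.add i2) i3 fun s _ => ?_
          simp only [hw, norm_mul]
          nlinarith [norm_nonneg (y s), norm_nonneg (z s), norm_nonneg (q s),
            mul_nonneg (norm_nonneg (q s)) (norm_nonneg (z s))]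

/-! ### The kernel: estimates and dependence on `k` -/

/-- Removes the case distinction at `k = 0`; regularity in `t` then comes from the fundamental
theorem of calculus. -/
theorem jostKernel_eq_integral (k : ℂ) (t : ℝ) :
    jostKernel k t = ∫ s in (0 : ℝ)..t, Complex.exp (2 * Complex.I * k * s) := by
  rw [jostKernel]
  split_ifs with hk
  · simp [hk]
  · rw [integral_exp_mul_complex (by simp [hk])]
    simp

theorem hasDerivAt_jostKernel (k : ℂ) (t : ℝ) :
    HasDerivAt (jostKernel k) (Complex.exp (2 * Complex.I * k * t)) t := by
  have hc : Continuous fun s : ℝ => Complex.exp (2 * Complex.I * k * s) := by fun_prop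
  rw [funext (jostKernel_eq_integral k)]
  exact intervalIntegral.integral_hasDerivAt_right (hc.intervalIntegrable _ _)
    (hc.stronglyMeasurableAtFilter _ _) hc.continuousAt

theorem continuous_jostKernel (k : ℂ) : Continuous (jostKernel k) :=
  continuous_iff_continuousAt.2 fun t => (hasDerivAt_jostKernel k t).continuousAt

theorem jostKernel_zero_right (k : ℂ) : jostKernel k 0 = 0 := by
  simp [jostKernel_eq_integral]

theorem norm_exp_two_I_mul (k : ℂ) (t : ℝ) :
    ‖Complex.exp (2 * Complex.I * k * t)‖ = Real.exp (-(2 * k.im) * t) := by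
  rw [Complex.norm_exp]
  congr 1
  simp

/-- The two exponentials in the numerator are each at most `e^{τt}`, and the resulting 2 cancels the
one in `2ik`. This is the sharp estimate used for counting zeros. -/
theorem norm_jostKernel_le_div {k : ℂ} (hk : k ≠ 0) {τ t : ℝ} (hτ : 0 ≤ τ)
    (hτk : -(2 * k.im) ≤ τ) (ht : 0 ≤ t) : ‖jostKernel k t‖ ≤ ‖k‖⁻¹ * Real.exp (τ * t) := by
  rw [jostKernel, if_neg hk, norm_div]
  have h1 : ‖Complex.exp (2 * Complex.I * k * t) - 1‖ ≤ 2 * Real.exp (τ * t) := by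
    refine (norm_sub_le _ _).trans ?_
    rw [norm_exp_two_I_mul, norm_one, two_mul (Real.exp _)]
    exact add_le_add (Real.exp_le_exp.2 (mul_le_mul_of_nonneg_right hτk ht))
      (Real.one_le_exp (mul_nonneg hτ ht))
  have h2 : ‖2 * Complex.I * k‖ = 2 * ‖k‖ := by simp
  have h3 : 0 < ‖k‖ := norm_pos_iff.2 hk
  rw [h2]
  calc _ ≤ 2 * Real.exp (τ * t) / (2 * ‖k‖) := by gcongr
    _ = _ := by field_simp

/-- Bounding the integral by its length gives `t e^{(a-δ)t}`, and `t ≤ e^{δt}/δ` absorbs the factor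
`t`. Unlike the bound by `1/|k|`, this one is uniform near `k = 0`. -/
theorem norm_jostKernel_le {k : ℂ} {a δ t : ℝ} (hδ : 0 < δ) (hδa : δ ≤ a)
    (hk : -(2 * k.im) ≤ a - δ) (ht : 0 ≤ t) : ‖jostKernel k t‖ ≤ δ⁻¹ * Real.exp (a * t) := by
  have h1 : ‖jostKernel k t‖ ≤ Real.exp ((a - δ) * t) * |t - 0| := by
    rw [jostKernel_eq_integral]
    refine intervalIntegral.norm_integral_le_of_norm_le_const fun s hs => ?_
    rw [uIoc_of_le ht] at hs
    rw [norm_exp_two_I_mul]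
    refine Real.exp_le_exp.2 ?_
    exact (mul_le_mul_of_nonneg_right hk hs.1.le).trans
      (mul_le_mul_of_nonneg_left hs.2 (by linarith))
  rw [sub_zero, abs_of_nonneg ht] at h1
  refine h1.trans ?_
  have h2 : t ≤ δ⁻¹ * Real.exp (δ * t) := by
    rw [inv_mul_eq_div, le_div_iff₀ hδ]
    linarith [Real.add_one_le_exp (δ * t)]
  calc _ ≤ Real.exp ((a - δ) * t) * (δ⁻¹ * Real.exp (δ * t)) := by gcongr
    _ = δ⁻¹ * (Real.exp ((a - δ) * t) * Real.exp (δ * t)) := by ring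
    _ = _ := by rw [← Real.exp_add]; ring_nf

/-- Up to the factor `1/(2i)` the kernel is the divided difference at zero of an entire function, so
the singularity at `k = 0` is removable. -/
theorem differentiable_jostKernel (t : ℝ) : Differentiable ℂ fun k => jostKernel k t := by
  have h : (fun k => jostKernel k t) = fun k =>
      (2 * Complex.I)⁻¹ * dslope (fun k : ℂ => Complex.exp (2 * Complex.I * k * t)) 0 k := by
    ext k
    by_cases hk : k = 0
    · subst hk
      have hd : HasDerivAt (fun k : ℂ => Complex.exp (2 * Complex.I * k * t))
          (Complex.exp (2 * Complex.I * 0 * t) * (2 * Complex.I * 1 * t)) 0 :=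
        (((hasDerivAt_id (0 : ℂ)).const_mul (2 * Complex.I)).mul_const (t : ℂ)).cexp
      rw [dslope_same, hd.deriv, jostKernel, if_pos rfl]
      field_simp
      simp
    · rw [dslope_of_ne _ hk, slope_def_field, jostKernel, if_neg hk]
      simp only [mul_zero, zero_mul, Complex.exp_zero, sub_zero]
      field_simp
  rw [h]
  have h2 : Differentiable ℂ (dslope (fun k : ℂ => Complex.exp (2 * Complex.I * k * t)) 0) := by
    rw [← differentiableOn_univ, Complex.differentiableOn_dslope univ_mem]
    exact Differentiable.differentiableOn (by fun_prop)
  exact h2.const_mul _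

/-! ### Successive approximations and the Volterra equation -/

/-- The tail `∫_x^∞ e^{τ t} |V t| dt`. -/
noncomputable def expTail (V : ℝ → ℂ) (τ x : ℝ) : ℝ :=
  ∫ t in Ioi x, Real.exp (τ * t) * ‖V t‖

/-- The kernel `jostKernel k` grows at most like `κ e^{τ t}`, and `e^{τ t} V` is integrable. -/
structure KernelBound (V : ℝ → ℂ) (k : ℂ) (κ τ : ℝ) : Prop where
  kappa_nonneg : 0 ≤ κ
  tau_nonneg : 0 ≤ τ
  le : ∀ t, 0 ≤ t → ‖jostKernel k t‖ ≤ κ * Real.exp (τ * t)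
  integrable : IntegrableOn (fun x : ℝ => (Real.exp (τ * x) : ℂ) * V x) (Ioi 0)

section Volterra

variable {V : ℝ → ℂ} {k : ℂ} {κ τ : ℝ}

theorem integrableOn_exp_mul_norm
    (hV : IntegrableOn (fun x : ℝ => (Real.exp (τ * x) : ℂ) * V x) (Ioi 0)) :
    IntegrableOn (fun t => Real.exp (τ * t) * ‖V t‖) (Ioi 0) := by
  refine hV.norm.congr (ae_of_all _ fun t => ?_)
  beta_reduce
  rw [norm_mul, Complex.norm_real, Real.norm_of_nonneg (Real.exp_pos _).le]

theorem aestronglyMeasurable_of_exp_mul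
    (hV : IntegrableOn (fun x : ℝ => (Real.exp (τ * x) : ℂ) * V x) (Ioi 0)) :
    AEStronglyMeasurable V (volume.restrict (Ioi 0)) := by
  have h1 : Continuous fun x : ℝ => (Real.exp (-(τ * x)) : ℂ) := by fun_prop
  refine (h1.aestronglyMeasurable.mul hV.aestronglyMeasurable).congr (ae_of_all _ fun t => ?_)
  simp only [Pi.mul_apply]
  rw [← mul_assoc, ← Complex.ofReal_mul, ← Real.exp_add]
  simp

theorem integrableOn_exp_mul_of_le {σ : ℝ} (h : σ ≤ τ)
    (hV : IntegrableOn (fun x : ℝ => (Real.exp (τ * x) : ℂ) * V x) (Ioi 0)) :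
    IntegrableOn (fun x : ℝ => (Real.exp (σ * x) : ℂ) * V x) (Ioi 0) := by
  have h1 : Continuous fun x : ℝ => (Real.exp (σ * x) : ℂ) := by fun_prop
  refine Integrable.mono' (integrableOn_exp_mul_norm hV)
    (h1.aestronglyMeasurable.mul (aestronglyMeasurable_of_exp_mul hV)) ?_
  refine (ae_restrict_iff' measurableSet_Ioi).2 (ae_of_all _ fun t ht => ?_)
  rw [norm_mul, Complex.norm_real, Real.norm_of_nonneg (Real.exp_pos _).le]
  have : (0 : ℝ) ≤ t := le_of_lt ht
  gcongr

theorem expTail_nonneg (V : ℝ → ℂ) (τ x : ℝ) : 0 ≤ expTail V τ x :=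
  integral_nonneg fun _ => by positivity

theorem expTail_anti (hV : IntegrableOn (fun x : ℝ => (Real.exp (τ * x) : ℂ) * V x) (Ioi 0))
    {x y : ℝ} (hx : 0 ≤ x) (hxy : x ≤ y) : expTail V τ y ≤ expTail V τ x :=
  setIntegral_mono_set ((integrableOn_exp_mul_norm hV).mono_set (Ioi_subset_Ioi hx))
    (ae_of_all _ fun _ => by positivity) (Ioi_subset_Ioi hxy).eventuallyLE

/-- One step of the successive approximations. -/
noncomputable def jostTransform (V : ℝ → ℂ) (k : ℂ) (m : ℝ → ℂ) (x : ℝ) : ℂ :=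
  ∫ ξ in Ioi x, jostKernel k (ξ - x) * V ξ * m ξ

theorem jostIterate_succ (n : ℕ) :
    jostIterate V k (n + 1) = jostTransform V k (jostIterate V k n) := rfl

theorem KernelBound.norm_integrand_le (h : KernelBound V k κ τ) {m : ℝ → ℂ} {x ξ : ℝ} (hx : 0 ≤ x)
    (hξ : 0 ≤ ξ) : ‖jostKernel k (max (ξ - x) 0) * V ξ * m ξ‖ ≤
      κ * (Real.exp (τ * ξ) * ‖V ξ‖ * ‖m ξ‖) := by
  rw [norm_mul, norm_mul]
  have h1 := h.le (max (ξ - x) 0) (le_max_right _ _)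
  have h2 : Real.exp (τ * max (ξ - x) 0) ≤ Real.exp (τ * ξ) :=
    Real.exp_le_exp.2 (mul_le_mul_of_nonneg_left (max_le (by linarith) hξ) h.tau_nonneg)
  calc _ ≤ κ * Real.exp (τ * ξ) * ‖V ξ‖ * ‖m ξ‖ := by
        gcongr
        exact h1.trans (mul_le_mul_of_nonneg_left h2 h.kappa_nonneg)
    _ = _ := by ring

/-- Since the kernel vanishes at `0`, truncating its argument lets the domain of integration be
independent of `x`. Dominated convergence in `x` and in `k` then applies directly. -/
theorem jostTransform_eq (m : ℝ → ℂ) {x : ℝ} (hx : 0 ≤ x) :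
    jostTransform V k m x = ∫ ξ in Ioi 0, jostKernel k (max (ξ - x) 0) * V ξ * m ξ := by
  rw [jostTransform]
  rw [setIntegral_eq_of_subset_of_forall_sdiff_eq_zero measurableSet_Ioi (Ioi_subset_Ioi hx)
    fun ξ hξ => ?_]
  rotate_left
  · have : ξ - x ≤ 0 := by
      have := hξ.2
      simp only [mem_Ioi, not_lt] at this
      linarith
    rw [max_eq_right this, jostKernel_zero_right]; ring
  · refine setIntegral_congr_fun measurableSet_Ioi fun ξ hξ => ?_
    have : 0 ≤ ξ - x := by
      have : x < ξ := hξ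
      linarith
    simp only [max_eq_left this]

theorem aestronglyMeasurable_integrand (hV : AEStronglyMeasurable V (volume.restrict (Ioi 0)))
    {m : ℝ → ℂ} (hm : ContinuousOn m (Ici 0)) (x : ℝ) :
    AEStronglyMeasurable (fun ξ => jostKernel k (max (ξ - x) 0) * V ξ * m ξ)
      (volume.restrict (Ioi 0)) := by
  have h1 : Continuous fun ξ => jostKernel k (max (ξ - x) 0) :=
    (continuous_jostKernel k).comp (by fun_prop)
  exact (h1.aestronglyMeasurable.mul hV).mul
    ((hm.mono Ioi_subset_Ici_self).aestronglyMeasurable measurableSet_Ioi)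

theorem KernelBound.integrableOn_bound (h : KernelBound V k κ τ) {m : ℝ → ℂ} {C : ℝ}
    (hm : ContinuousOn m (Ici 0)) (hC : ∀ x, 0 ≤ x → ‖m x‖ ≤ C) :
    IntegrableOn (fun ξ => κ * (Real.exp (τ * ξ) * ‖V ξ‖ * ‖m ξ‖)) (Ioi 0) := by
  refine (Integrable.mul_bdd (c := C) (integrableOn_exp_mul_norm h.integrable) ?_ ?_).const_mul κ
  · exact (hm.mono Ioi_subset_Ici_self).norm.aestronglyMeasurable measurableSet_Ioi
  · refine (ae_restrict_iff' measurableSet_Ioi).2 (ae_of_all _ fun t ht => ?_)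
    rw [norm_norm]
    exact hC t (le_of_lt ht)

theorem KernelBound.integrableOn_integrand (h : KernelBound V k κ τ) {m : ℝ → ℂ} {C : ℝ}
    (hm : ContinuousOn m (Ici 0)) (hC : ∀ x, 0 ≤ x → ‖m x‖ ≤ C) {x : ℝ} (hx : 0 ≤ x) :
    IntegrableOn (fun ξ => jostKernel k (max (ξ - x) 0) * V ξ * m ξ) (Ioi 0) :=
  Integrable.mono' (h.integrableOn_bound hm hC)
    (aestronglyMeasurable_integrand (aestronglyMeasurable_of_exp_mul h.integrable) hm x)
    ((ae_restrict_iff' measurableSet_Ioi).2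
      (ae_of_all _ fun _ ht => h.norm_integrand_le hx (le_of_lt ht)))

theorem KernelBound.continuousOn_jostTransform (h : KernelBound V k κ τ) {m : ℝ → ℂ} {C : ℝ}
    (hm : ContinuousOn m (Ici 0)) (hC : ∀ x, 0 ≤ x → ‖m x‖ ≤ C) :
    ContinuousOn (jostTransform V k m) (Ici 0) := by
  have h1 : ContinuousOn (fun x => ∫ ξ in Ioi 0, jostKernel k (max (ξ - x) 0) * V ξ * m ξ)
      (Ici 0) := by
    refine continuousOn_of_dominated
      (bound := fun ξ => κ * (Real.exp (τ * ξ) * ‖V ξ‖ * ‖m ξ‖)) ?_ ?_ ?_ ?_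
    · exact fun x _ =>
        aestronglyMeasurable_integrand (aestronglyMeasurable_of_exp_mul h.integrable) hm x
    · exact fun x hx => (ae_restrict_iff' measurableSet_Ioi).2
        (ae_of_all _ fun _ ht => h.norm_integrand_le hx (le_of_lt ht))
    · exact h.integrableOn_bound hm hC
    · refine ae_of_all _ fun ξ => Continuous.continuousOn ?_
      have : Continuous fun x => jostKernel k (max (ξ - x) 0) :=
        (continuous_jostKernel k).comp (by fun_prop)
      fun_prop
  exact h1.congr fun x hx => jostTransform_eq m hx

theorem KernelBound.norm_jostTransform_le (h : KernelBound V k κ τ) {m : ℝ → ℂ} {C : ℝ} {n : ℕ}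
    (hC : ∀ x, 0 ≤ x → ‖m x‖ ≤ C * expTail V τ x ^ n) {x : ℝ} (hx : 0 ≤ x) :
    ‖jostTransform V k m x‖ ≤ κ * C * (expTail V τ x ^ (n + 1) / (n + 1)) := by
  have hi := integral_tail_pow (integrableOn_exp_mul_norm h.integrable) n hx
  have e1 : expTail V τ x ^ (n + 1) / (n + 1) =
      ∫ t in Ioi x, Real.exp (τ * t) * ‖V t‖ * expTail V τ t ^ n := hi.2.symm
  rw [e1, ← integral_const_mul, jostTransform]
  refine norm_integral_le_of_norm_le ((hi.1.mono_set (Ioi_subset_Ioi hx)).const_mul _)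
    ((ae_restrict_iff' measurableSet_Ioi).2 (ae_of_all _ fun ξ hξ => ?_))
  have hxξ : x < ξ := hξ
  have h1 := h.norm_integrand_le (m := m) hx (hx.trans hxξ.le)
  rw [max_eq_left (by linarith)] at h1
  refine h1.trans ?_
  have h2 := hC ξ (hx.trans hxξ.le)
  have h3 := h.kappa_nonneg
  calc _ ≤ κ * (Real.exp (τ * ξ) * ‖V ξ‖ * (C * expTail V τ ξ ^ n)) := by gcongr
    _ = _ := by simp only [expTail]; ring

/-- For `x ≥ 0` the kernel at `ξ - x` is at most `κ e^{τξ}`, so each step integrates a power of the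
tail against its own density. Continuity is carried along in the induction to provide measurability.
-/
theorem KernelBound.jostIterate_spec (h : KernelBound V k κ τ) (n : ℕ) :
    ContinuousOn (jostIterate V k n) (Ici 0) ∧
      ∀ x, 0 ≤ x → ‖jostIterate V k n x‖ ≤ (κ * expTail V τ x) ^ n / n.factorial := by
  have hκ := h.kappa_nonneg
  induction n with
  | zero => exact ⟨continuousOn_const, fun x _ => by simp [jostIterate]⟩
  | succ n ih =>
    have hb : ∀ x, 0 ≤ x → ‖jostIterate V k n x‖ ≤ κ ^ n / n.factorial * expTail V τ x ^ n :=
      fun x hx => (ih.2 x hx).trans (le_of_eq (by rw [mul_pow]; ring))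
    refine ⟨?_, fun x hx => ?_⟩
    · rw [jostIterate_succ]
      refine h.continuousOn_jostTransform (C := κ ^ n / n.factorial * expTail V τ 0 ^ n) ih.1
        fun x hx => (hb x hx).trans ?_
      have := expTail_anti h.integrable le_rfl hx
      have := expTail_nonneg V τ x
      gcongr
    · rw [jostIterate_succ]
      refine (h.norm_jostTransform_le hb hx).trans (le_of_eq ?_)
      rw [Nat.factorial_succ, mul_pow]
      push_cast
      field_simp
      ring

/-- The sum of the successive approximations, `e^{-ikx} e(x, k)`. -/
noncomputable def jostAmplitude (V : ℝ → ℂ) (k : ℂ) (x : ℝ) : ℂ := ∑' n : ℕ, jostIterate V k n x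

theorem KernelBound.hasSum_bound (V : ℝ → ℂ) (κ τ x : ℝ) :
    HasSum (fun n : ℕ => (κ * expTail V τ x) ^ n / n.factorial) (Real.exp (κ * expTail V τ x)) := by
  rw [Real.exp_eq_exp_ℝ]
  exact NormedSpace.expSeries_div_hasSum_exp _

theorem KernelBound.summable (h : KernelBound V k κ τ) {x : ℝ} (hx : 0 ≤ x) :
    Summable fun n : ℕ => jostIterate V k n x :=
  (hasSum_bound V κ τ x).summable.of_norm_bounded fun n => (h.jostIterate_spec n).2 x hx

theorem KernelBound.norm_jostAmplitude_le (h : KernelBound V k κ τ) {x : ℝ} (hx : 0 ≤ x) :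
    ‖jostAmplitude V k x‖ ≤ Real.exp (κ * expTail V τ x) :=
  tsum_of_norm_bounded (hasSum_bound V κ τ x) fun n => (h.jostIterate_spec n).2 x hx

theorem KernelBound.norm_jostAmplitude_sub_one_le (h : KernelBound V k κ τ) {x : ℝ} (hx : 0 ≤ x) :
    ‖jostAmplitude V k x - 1‖ ≤ Real.exp (κ * expTail V τ x) - 1 := by
  have h1 := (h.summable hx).hasSum.sub (hasSum_ite_eq 0 (1 : ℂ))
  have h2 := (hasSum_bound V κ τ x).sub (hasSum_ite_eq 0 (1 : ℝ))
  rw [jostAmplitude, ← h1.tsum_eq]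
  refine tsum_of_norm_bounded h2 fun n => ?_
  rcases n with _ | n
  · simp [jostIterate]
  · simpa using (h.jostIterate_spec (n + 1)).2 x hx

theorem KernelBound.continuousOn_jostAmplitude (h : KernelBound V k κ τ) :
    ContinuousOn (jostAmplitude V k) (Ici 0) := by
  refine continuousOn_tsum (fun n => (h.jostIterate_spec n).1)
    (hasSum_bound V κ τ 0).summable fun n x hx => ((h.jostIterate_spec n).2 x hx).trans ?_
  have h1 := expTail_anti h.integrable le_rfl (show (0 : ℝ) ≤ x from hx)
  have h2 := expTail_nonneg V τ x
  have := h.kappa_nonneg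
  gcongr

theorem KernelBound.norm_jostAmplitude_le' (h : KernelBound V k κ τ) {x : ℝ} (hx : 0 ≤ x) :
    ‖jostAmplitude V k x‖ ≤ Real.exp (κ * expTail V τ 0) :=
  (h.norm_jostAmplitude_le hx).trans <| Real.exp_le_exp.2 <|
    mul_le_mul_of_nonneg_left (expTail_anti h.integrable le_rfl hx) h.kappa_nonneg

/-- The Volterra equation for the Jost amplitude. -/
theorem KernelBound.jostAmplitude_eq (h : KernelBound V k κ τ) {x : ℝ} (hx : 0 ≤ x) :
    jostAmplitude V k x = 1 + jostTransform V k (jostAmplitude V k) x := by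
  have hκ := h.kappa_nonneg
  have hJ0 := expTail_nonneg V τ 0
  have hb : ∀ (n : ℕ) (y : ℝ), 0 ≤ y →
      ‖jostIterate V k n y‖ ≤ (κ * expTail V τ 0) ^ n / n.factorial := by
    intro n y hy
    refine ((h.jostIterate_spec n).2 y hy).trans ?_
    have h1 := expTail_anti h.integrable le_rfl hy
    have h2 := expTail_nonneg V τ y
    gcongr
  have hint := fun n => h.integrableOn_integrand (h.jostIterate_spec n).1 (hb n) hx
  -- Summability of the `L¹` norms, again by the exponential series, justifies exchanging sum and
  -- integral.
  have hsum : Summable fun n : ℕ =>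
      ∫ ξ in Ioi 0, ‖jostKernel k (max (ξ - x) 0) * V ξ * jostIterate V k n ξ‖ := by
    refine Summable.of_nonneg_of_le (fun n => integral_nonneg fun _ => norm_nonneg _) (fun n => ?_)
      ((hasSum_bound V κ τ 0).summable.mul_left (κ * expTail V τ 0))
    have hbn := hb n
    generalize (κ * expTail V τ 0) ^ n / (n.factorial : ℝ) = B at hbn ⊢
    rw [expTail, ← integral_const_mul, ← integral_mul_const]
    refine integral_mono_of_nonneg (ae_of_all _ fun _ => norm_nonneg _)
      (((integrableOn_exp_mul_norm h.integrable).const_mul κ).mul_const _)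
      ((ae_restrict_iff' measurableSet_Ioi).2 (ae_of_all _ fun ξ hξ => ?_))
    refine (h.norm_integrand_le hx (le_of_lt hξ)).trans ?_
    have h2 := hbn ξ (le_of_lt hξ)
    calc _ ≤ κ * (Real.exp (τ * ξ) * ‖V ξ‖ * B) := by gcongr
      _ = _ := by ring
  have h1 := hasSum_integral_of_summable_integral_norm hint hsum
  have h2 : ∀ n, ∫ ξ in Ioi 0, jostKernel k (max (ξ - x) 0) * V ξ * jostIterate V k n ξ
      = jostIterate V k (n + 1) x := fun n => by rw [jostIterate_succ, jostTransform_eq _ hx]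
  simp only [h2, tsum_mul_left] at h1
  rw [jostTransform_eq _ hx]
  simp only [jostAmplitude]
  rw [← h1.tsum_eq, (h.summable hx).tsum_eq_zero_add]
  simp [jostIterate]

end Volterra

/-! ### The Jost solution solves the differential equation -/

theorem isPrimitive_exp (c : ℂ) :
    IsPrimitive (fun x : ℝ => Complex.exp (c * x)) (fun x : ℝ => c * Complex.exp (c * x)) := by
  refine isPrimitive_of_hasDerivWithinAt (fun x _ => HasDerivAt.hasDerivWithinAt ?_)
    (Continuous.continuousOn (by fun_prop))
  have h := ((Complex.ofRealCLM.hasDerivAt (x := x)).const_mul c).cexp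
  simpa [mul_comm] using h

/-- The Jost data of an exponentially decaying potential: `e^{a x} V` is integrable with `a > 0`. -/
structure ExpDecay (V : ℝ → ℂ) (a : ℝ) : Prop where
  pos : 0 < a
  integrable : IntegrableOn (fun x : ℝ => (Real.exp (a * x) : ℂ) * V x) (Ioi 0)

theorem ExpDecay.kernelBound {V : ℝ → ℂ} {a : ℝ} (h : ExpDecay V a) {k : ℂ} (hk : 0 ≤ k.im) :
    KernelBound V k a⁻¹ a :=
  ⟨(inv_pos.2 h.pos).le, h.pos.le,
    fun _ ht => norm_jostKernel_le h.pos le_rfl (by linarith) ht, h.integrable⟩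

theorem ExpDecay.integrableOn {V : ℝ → ℂ} {a : ℝ} (h : ExpDecay V a) : IntegrableOn V (Ioi 0) := by
  simpa using integrableOn_exp_mul_of_le (σ := 0) h.pos.le h.integrable

theorem ExpDecay.intervalIntegrable {V : ℝ → ℂ} {a : ℝ} (h : ExpDecay V a) {x : ℝ} (hx : 0 ≤ x) :
    IntervalIntegrable V volume 0 x :=
  (intervalIntegrable_iff_integrableOn_Ioc_of_le hx).2 (h.integrableOn.mono_set Ioc_subset_Ioi_self)

/-- `∫_x^∞ e^{2ik(ξ - x)} V(ξ) m(ξ) dξ`, minus the derivative of the Jost amplitude. -/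
noncomputable def jostSlope (V : ℝ → ℂ) (k : ℂ) (x : ℝ) : ℂ :=
  Complex.exp (-(2 * Complex.I * k) * x) *
    ∫ ξ in Ioi x, Complex.exp (2 * Complex.I * k * ξ) * (V ξ * jostAmplitude V k ξ)

/-- The derivative in `x` of the Jost solution. -/
noncomputable def jostDeriv (V : ℝ → ℂ) (k : ℂ) (x : ℝ) : ℂ :=
  Complex.I * k * jostSolution V x k - Complex.exp (Complex.I * k * x) * jostSlope V k x

theorem jostSolution_eq (V : ℝ → ℂ) (k : ℂ) (x : ℝ) :
    jostSolution V x k = Complex.exp (Complex.I * k * x) * jostAmplitude V k x := rfl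

section Equation

variable {V : ℝ → ℂ} {a : ℝ} {k : ℂ}

theorem ExpDecay.integrableOn_mul_jostAmplitude (h : ExpDecay V a) (hk : 0 ≤ k.im) :
    IntegrableOn (fun ξ => V ξ * jostAmplitude V k ξ) (Ioi 0) := by
  have hK := h.kernelBound hk
  refine Integrable.mul_bdd (c := Real.exp (a⁻¹ * expTail V a 0)) h.integrableOn ?_ ?_
  · exact (hK.continuousOn_jostAmplitude.mono Ioi_subset_Ici_self).aestronglyMeasurable
      measurableSet_Ioi
  · exact (ae_restrict_iff' measurableSet_Ioi).2
      (ae_of_all _ fun t ht => hK.norm_jostAmplitude_le' (le_of_lt ht))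

theorem norm_exp_two_I_mul_le_one (hk : 0 ≤ k.im) {t : ℝ} (ht : 0 ≤ t) :
    ‖Complex.exp (2 * Complex.I * k * t)‖ ≤ 1 := by
  rw [norm_exp_two_I_mul, Real.exp_le_one_iff]
  nlinarith

theorem ExpDecay.integrableOn_exp_mul (h : ExpDecay V a) (hk : 0 ≤ k.im) :
    IntegrableOn (fun ξ : ℝ => Complex.exp (2 * Complex.I * k * ξ) * (V ξ * jostAmplitude V k ξ))
      (Ioi 0) := by
  refine Integrable.bdd_mul (c := 1) (h.integrableOn_mul_jostAmplitude hk)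
    (Continuous.aestronglyMeasurable (by fun_prop)) ?_
  exact (ae_restrict_iff' measurableSet_Ioi).2
    (ae_of_all _ fun t ht => norm_exp_two_I_mul_le_one hk (le_of_lt ht))

theorem ExpDecay.integrableOn_id_mul (h : ExpDecay V a) (hk : 0 ≤ k.im) :
    IntegrableOn (fun ξ : ℝ => (ξ : ℂ) * (V ξ * jostAmplitude V k ξ)) (Ioi 0) := by
  have hK := h.kernelBound hk
  have hm := (hK.continuousOn_jostAmplitude.mono Ioi_subset_Ici_self).aestronglyMeasurable
      measurableSet_Ioi (μ := volume)
  refine Integrable.mono' ((integrableOn_exp_mul_norm h.integrable).const_mul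
    (a⁻¹ * Real.exp (a⁻¹ * expTail V a 0))) ?_ ?_
  · exact (Complex.continuous_ofReal.aestronglyMeasurable).mul
      ((aestronglyMeasurable_of_exp_mul h.integrable).mul hm)
  · refine (ae_restrict_iff' measurableSet_Ioi).2 (ae_of_all _ fun t ht => ?_)
    have ht0 : (0 : ℝ) ≤ t := le_of_lt ht
    have h1 := hK.norm_jostAmplitude_le' ht0
    have h2 : t ≤ a⁻¹ * Real.exp (a * t) := by
      rw [inv_mul_eq_div, le_div_iff₀ h.pos]
      linarith [Real.add_one_le_exp (a * t)]
    rw [norm_mul, norm_mul, Complex.norm_real, Real.norm_of_nonneg ht0]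
    have h3 := h.pos
    calc t * (‖V t‖ * ‖jostAmplitude V k t‖)
        ≤ (a⁻¹ * Real.exp (a * t)) * (‖V t‖ * Real.exp (a⁻¹ * expTail V a 0)) := by gcongr
      _ = _ := by ring

/-- With `m` the amplitude and `S` the slope, this is `S' = -2ik S - V m`. Together with `m' = -S`
it is the first-order form of `m'' + 2ik m' = V m`. -/
theorem ExpDecay.isPrimitive_jostSlope (h : ExpDecay V a) (hk : 0 ≤ k.im) :
    IsPrimitive (jostSlope V k)
      (fun x => -(2 * Complex.I * k) * jostSlope V k x - V x * jostAmplitude V k x) := by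
  have h1 := (isPrimitive_exp (-(2 * Complex.I * k))).mul (isPrimitive_tail (h.integrableOn_exp_mul hk))
  refine h1.congr (ae_of_all _ fun x => ?_)
  have h2 : Complex.exp (-(2 * Complex.I * k) * x) * Complex.exp (2 * Complex.I * k * x) = 1 := by
    rw [← Complex.exp_add]; simp
  simp only [jostSlope]
  linear_combination (-(V x * jostAmplitude V k x)) * h2

/-- The kernel separates the variables `x` and `ξ`, as `ξ - x` for `k = 0` and as a difference of
exponentials otherwise. The transform thus becomes a combination of tail integrals that can be
differentiated by the product rule. -/
theorem ExpDecay.isPrimitive_jostTransform (h : ExpDecay V a) (hk : 0 ≤ k.im) :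
    IsPrimitive (jostTransform V k (jostAmplitude V k)) (fun x => -jostSlope V k x) := by
  have hq := h.integrableOn_mul_jostAmplitude hk
  have hQ := isPrimitive_tail hq
  by_cases hk0 : k = 0
  · have h1 : IsPrimitive (fun x : ℝ => (x : ℂ)) (fun _ => 1) := by
      refine isPrimitive_of_hasDerivWithinAt (fun x _ => HasDerivAt.hasDerivWithinAt ?_)
        continuousOn_const
      exact Complex.ofRealCLM.hasDerivAt (x := x)
    have h2 := (isPrimitive_tail (h.integrableOn_id_mul hk)).sub (h1.mul hQ)
    have h3 : ∀ x : ℝ, 0 ≤ x → jostTransform V k (jostAmplitude V k) x =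
        (∫ ξ in Ioi x, (ξ : ℂ) * (V ξ * jostAmplitude V k ξ)) -
          x * ∫ ξ in Ioi x, V ξ * jostAmplitude V k ξ := by
      intro x hx
      rw [jostTransform, ← integral_const_mul, ← integral_sub
        ((h.integrableOn_id_mul hk).mono_set (Ioi_subset_Ioi hx))
        ((hq.mono_set (Ioi_subset_Ioi hx)).const_mul _)]
      refine setIntegral_congr_fun measurableSet_Ioi fun ξ _ => ?_
      simp only [jostKernel, if_pos hk0]
      push_cast
      ring
    intro x hx
    rw [h3 x hx, h3 0 le_rfl]
    have h4 := h2.congr (g := fun x => -jostSlope V k x) (ae_of_all _ fun x => by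
      simp only [jostSlope, hk0]; simp)
    exact h4 x hx
  · have h2 := ((h.isPrimitive_jostSlope hk).sub hQ).const_mul (2 * Complex.I * k)⁻¹
    have h3 : ∀ x : ℝ, 0 ≤ x → jostTransform V k (jostAmplitude V k) x =
        (2 * Complex.I * k)⁻¹ * (jostSlope V k x - ∫ ξ in Ioi x, V ξ * jostAmplitude V k ξ) := by
      intro x hx
      rw [jostTransform, jostSlope, ← integral_const_mul, ← integral_sub
        (((h.integrableOn_exp_mul hk).mono_set (Ioi_subset_Ioi hx)).const_mul _)
        (hq.mono_set (Ioi_subset_Ioi hx)), ← integral_const_mul]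
      refine setIntegral_congr_fun measurableSet_Ioi fun ξ _ => ?_
      simp only [jostKernel, if_neg hk0]
      have : Complex.exp (2 * Complex.I * k * ((ξ - x : ℝ) : ℂ)) =
          Complex.exp (-(2 * Complex.I * k) * x) * Complex.exp (2 * Complex.I * k * ξ) := by
        rw [← Complex.exp_add]; congr 1; push_cast; ring
      rw [this]
      field_simp
    intro x hx
    rw [h3 x hx, h3 0 le_rfl]
    have h4 := h2.congr (g := fun x => -jostSlope V k x) (ae_of_all _ fun x => by
      field_simp; ring)
    exact h4 x hx

theorem ExpDecay.isPrimitive_jostAmplitude (h : ExpDecay V a) (hk : 0 ≤ k.im) :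
    IsPrimitive (jostAmplitude V k) (fun x => -jostSlope V k x) := by
  intro x hx
  have h1 := h.isPrimitive_jostTransform hk x hx
  refine ⟨h1.1, ?_⟩
  rw [(h.kernelBound hk).jostAmplitude_eq hx, (h.kernelBound hk).jostAmplitude_eq le_rfl, h1.2]
  ring

theorem ExpDecay.isPrimitive_jostSolution (h : ExpDecay V a) (hk : 0 ≤ k.im) :
    IsPrimitive (fun x => jostSolution V x k) (jostDeriv V k) := by
  have h1 := (isPrimitive_exp (Complex.I * k)).mul (h.isPrimitive_jostAmplitude hk)
  refine h1.congr (ae_of_all _ fun x => ?_)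
  simp only [jostDeriv, jostSolution_eq]
  ring

theorem ExpDecay.isPrimitive_jostDeriv (h : ExpDecay V a) (hk : 0 ≤ k.im) :
    IsPrimitive (jostDeriv V k) (fun x => (V x - k ^ 2) * jostSolution V x k) := by
  have h1 := ((h.isPrimitive_jostSolution hk).const_mul (Complex.I * k)).sub
    ((isPrimitive_exp (Complex.I * k)).mul (h.isPrimitive_jostSlope hk))
  refine h1.congr (ae_of_all _ fun x => ?_)
  simp only [jostDeriv, jostSolution_eq]
  linear_combination (k ^ 2 * Complex.exp (Complex.I * k * x) * jostAmplitude V k x) * Complex.I_sq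

theorem norm_exp_I_mul (k : ℂ) (x : ℝ) :
    ‖Complex.exp (Complex.I * k * x)‖ = Real.exp (-(k.im * x)) := by
  rw [Complex.norm_exp]
  congr 1
  simp

theorem ExpDecay.norm_jostSolution_le (h : ExpDecay V a) (hk : 0 ≤ k.im) {x : ℝ} (hx : 0 ≤ x) :
    ‖jostSolution V x k‖ ≤ Real.exp (a⁻¹ * expTail V a 0) * Real.exp (-(k.im * x)) := by
  rw [jostSolution_eq, norm_mul, norm_exp_I_mul, mul_comm]
  gcongr
  exact (h.kernelBound hk).norm_jostAmplitude_le' hx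

theorem ExpDecay.norm_jostSlope_le (h : ExpDecay V a) (hk : 0 ≤ k.im) {x : ℝ} (hx : 0 ≤ x) :
    ‖jostSlope V k x‖ ≤ ∫ ξ in Ioi 0, ‖V ξ * jostAmplitude V k ξ‖ := by
  have hq : IntegrableOn (fun ξ => ‖V ξ * jostAmplitude V k ξ‖) (Ioi 0) :=
    (h.integrableOn_mul_jostAmplitude hk).norm
  rw [jostSlope, ← integral_const_mul]
  refine (norm_integral_le_of_norm_le (hq.mono_set (Ioi_subset_Ioi hx))
    ((ae_restrict_iff' measurableSet_Ioi).2 (ae_of_all _ fun ξ hξ => ?_))).trans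
    (setIntegral_mono_set hq (ae_of_all _ fun _ => norm_nonneg _) (Ioi_subset_Ioi hx).eventuallyLE)
  have hξ' : x < ξ := hξ
  rw [← mul_assoc, ← Complex.exp_add, norm_mul]
  have : -(2 * Complex.I * k) * x + 2 * Complex.I * k * ξ = 2 * Complex.I * k * ((ξ - x : ℝ) : ℂ) := by
    push_cast; ring
  rw [this]
  exact mul_le_of_le_one_left (norm_nonneg _) (norm_exp_two_I_mul_le_one hk (by linarith))

theorem ExpDecay.exists_norm_jostDeriv_le (h : ExpDecay V a) (hk : 0 ≤ k.im) :
    ∃ C : ℝ, ∀ x : ℝ, 0 ≤ x → ‖jostDeriv V k x‖ ≤ C := by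
  refine ⟨‖k‖ * Real.exp (a⁻¹ * expTail V a 0) + ∫ ξ in Ioi 0, ‖V ξ * jostAmplitude V k ξ‖,
    fun x hx => ?_⟩
  have h1 : Real.exp (-(k.im * x)) ≤ 1 := Real.exp_le_one_iff.2 (by nlinarith)
  have h2 := h.norm_jostSolution_le hk hx
  have h3 := h.norm_jostSlope_le hk hx
  refine (norm_sub_le _ _).trans ?_
  rw [norm_mul, norm_mul, norm_mul, Complex.norm_I, one_mul, norm_exp_I_mul]
  refine add_le_add ?_ ?_
  · gcongr
    refine h2.trans (mul_le_of_le_one_right (Real.exp_pos _).le h1)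
  · exact (mul_le_of_le_one_left (norm_nonneg _) h1).trans h3

theorem ExpDecay.tendsto_jostAmplitude (h : ExpDecay V a) (hk : 0 ≤ k.im) :
    Tendsto (jostAmplitude V k) atTop (𝓝 1) := by
  have h1 : Tendsto (fun x => Real.exp (a⁻¹ * expTail V a x) - 1) atTop
      (𝓝 (Real.exp (a⁻¹ * 0) - 1)) :=
    (((tendsto_tail (integrableOn_exp_mul_norm h.integrable)).const_mul a⁻¹).rexp).sub_const 1
  rw [mul_zero, Real.exp_zero, sub_self] at h1
  rw [tendsto_iff_norm_sub_tendsto_zero]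
  refine squeeze_zero' (Eventually.of_forall fun _ => norm_nonneg _) ?_ h1
  filter_upwards [eventually_ge_atTop 0] with x hx
  exact (h.kernelBound hk).norm_jostAmplitude_sub_one_le hx

end Equation

/-! ### Holomorphy of the Jost function -/

/-- Holomorphic dependence on a parameter of a dominated integral. -/
theorem differentiableOn_integral_of_dominated {α : Type*} [MeasurableSpace α] {μ : Measure α}
    {F : ℂ → α → ℂ} {U : Set ℂ} {bound : α → ℝ} (hU : IsOpen U)
    (hF : ∀ᵐ x ∂μ, DifferentiableOn ℂ (fun k => F k x) U)
    (hmeas : ∀ k ∈ U, AEStronglyMeasurable (F k) μ)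
    (hbound : ∀ᵐ x ∂μ, ∀ k ∈ U, ‖F k x‖ ≤ bound x) (hint : Integrable bound μ) :
    DifferentiableOn ℂ (fun k => ∫ x, F k x ∂μ) U := by
  intro k₀ hk₀
  obtain ⟨ε, hε, hball⟩ := Metric.isOpen_iff.1 hU k₀ hk₀
  -- Discs of radius `ε/3` about points of the ball of radius `ε/3` stay in `U`, so Cauchy's
  -- estimate turns the bound on `F` into one on its derivative.
  have hρ : 0 < ε / 3 := by positivity
  have hsub : ∀ k ∈ Metric.ball k₀ (ε / 3), Metric.closedBall k (ε / 3) ⊆ U := by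
    intro k hk w hw
    refine hball ?_
    rw [Metric.mem_ball] at hk ⊢
    rw [Metric.mem_closedBall] at hw
    linarith [dist_triangle w k k₀]
  have hsub' : Metric.ball k₀ (ε / 3) ⊆ U := fun k hk =>
    hsub k hk (Metric.mem_closedBall_self hρ.le)
  -- The derivative is a pointwise limit of difference quotients along a sequence; the index shift
  -- by `N` keeps its points in `U`.
  have hmeas' : AEStronglyMeasurable (fun x => deriv (fun k => F k x) k₀) μ := by
    have hu : Tendsto (fun n : ℕ => k₀ + ((ε / 6 : ℝ) : ℂ) * (1 / ((n : ℂ) + 1))) atTop (𝓝[≠] k₀) := by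
      refine tendsto_nhdsWithin_iff.2 ⟨?_, Eventually.of_forall fun n => ?_⟩
      · have h1 := (tendsto_one_div_add_atTop_nhds_zero_nat (𝕜 := ℂ)).const_mul ((ε / 6 : ℝ) : ℂ)
        simpa using h1.const_add k₀
      · have h2 : ((n : ℂ) + 1) ≠ 0 := Nat.cast_add_one_ne_zero n
        have h3 : ((ε / 6 : ℝ) : ℂ) ≠ 0 := by
          rw [Complex.ofReal_ne_zero]; positivity
        simp only [mem_compl_iff, mem_singleton_iff, add_eq_left]
        exact mul_ne_zero h3 (one_div_ne_zero h2)
    have huU : ∀ᶠ n : ℕ in atTop, k₀ + ((ε / 6 : ℝ) : ℂ) * (1 / ((n : ℂ) + 1)) ∈ U :=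
      (hu.mono_right nhdsWithin_le_nhds).eventually (hU.mem_nhds hk₀)
    obtain ⟨N, hN⟩ := eventually_atTop.1 huU
    refine aestronglyMeasurable_of_tendsto_ae (u := atTop) (f := fun n : ℕ => fun x =>
      slope (fun k => F k x) k₀ (k₀ + ((ε / 6 : ℝ) : ℂ) * (1 / (((n + N : ℕ) : ℂ) + 1)))) ?_ ?_
    · intro n
      simp only [slope_def_field]
      exact ((hmeas _ (hN _ (Nat.le_add_left N n))).sub (hmeas _ hk₀)).mul
        aestronglyMeasurable_const
    · filter_upwards [hF] with x hx
      have h1 := ((hx k₀ hk₀).differentiableAt (hU.mem_nhds hk₀)).hasDerivAt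
      exact (h1.tendsto_slope.comp hu).comp (tendsto_add_atTop_nat N)
  have hmain := hasDerivAt_integral_of_dominated_loc_of_deriv_le (μ := μ) (𝕜 := ℂ) (F := F)
    (x₀ := k₀) (s := Metric.ball k₀ (ε / 3)) (F' := fun k x => deriv (fun k => F k x) k)
    (bound := fun x => bound x / (ε / 3)) (Metric.ball_mem_nhds k₀ hρ)
    (Filter.eventually_of_mem (hU.mem_nhds hk₀) hmeas)
    (Integrable.mono' hint (hmeas k₀ hk₀) (hbound.mono fun x hx => hx k₀ hk₀)) hmeas'
    (by
      filter_upwards [hF, hbound] with x hx hb k hk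
      refine Complex.norm_deriv_le_of_forall_mem_sphere_norm_le hρ
        ((hx.mono ?_).diffContOnCl) fun w hw => hb w (hsub k hk (Metric.sphere_subset_closedBall hw))
      rw [closure_ball _ hρ.ne']
      exact hsub k hk)
    (hint.div_const _)
    (by
      filter_upwards [hF] with x hx k hk
      exact ((hx k (hsub' hk)).differentiableAt (hU.mem_nhds (hsub' hk))).hasDerivAt)
  exact hmain.2.differentiableAt.differentiableWithinAt

section

variable {V : ℝ → ℂ} {a : ℝ}

theorem ExpDecay.kernelBound' (h : ExpDecay V a) {δ : ℝ} (hδ : 0 < δ) (hδa : δ ≤ a) {k : ℂ}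
    (hk : -(2 * k.im) ≤ a - δ) : KernelBound V k δ⁻¹ a :=
  ⟨(inv_pos.2 hδ).le, h.pos.le, fun _ ht => norm_jostKernel_le hδ hδa hk ht, h.integrable⟩

theorem isOpen_im_gt (c : ℝ) : IsOpen {k : ℂ | -(2 * k.im) < c} :=
  isOpen_lt (by fun_prop) continuous_const

theorem ExpDecay.differentiableOn_jostIterate (h : ExpDecay V a) {δ : ℝ} (hδ : 0 < δ) (hδa : δ ≤ a)
    (n : ℕ) : ∀ x : ℝ, 0 ≤ x →
      DifferentiableOn ℂ (fun k => jostIterate V k n x) {k : ℂ | -(2 * k.im) < a - δ} := by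
  induction n with
  | zero => exact fun x _ => differentiableOn_const _
  | succ n ih =>
    intro x hx
    have hK : ∀ k ∈ {k : ℂ | -(2 * k.im) < a - δ}, KernelBound V k δ⁻¹ a := fun k hk =>
      h.kernelBound' hδ hδa (le_of_lt hk)
    have h1 : DifferentiableOn ℂ (fun k => ∫ ξ in Ioi 0,
        jostKernel k (max (ξ - x) 0) * V ξ * jostIterate V k n ξ) {k : ℂ | -(2 * k.im) < a - δ} := by
      refine differentiableOn_integral_of_dominated (isOpen_im_gt _)
        (bound := fun ξ => δ⁻¹ * (Real.exp (a * ξ) * ‖V ξ‖ *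
          ((δ⁻¹ * expTail V a 0) ^ n / n.factorial))) ?_ ?_ ?_ ?_
      · refine (ae_restrict_iff' measurableSet_Ioi).2 (ae_of_all _ fun ξ hξ => ?_)
        exact (((differentiable_jostKernel _).differentiableOn).mul_const _).mul
          (ih ξ (le_of_lt hξ))
      · exact fun k hk => aestronglyMeasurable_integrand
          (aestronglyMeasurable_of_exp_mul h.integrable) ((hK k hk).jostIterate_spec n).1 x
      · refine (ae_restrict_iff' measurableSet_Ioi).2 (ae_of_all _ fun ξ hξ k hk => ?_)
        have hξ0 : (0 : ℝ) ≤ ξ := le_of_lt hξ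
        refine ((hK k hk).norm_integrand_le hx hξ0).trans ?_
        have h2 := ((hK k hk).jostIterate_spec n).2 ξ hξ0
        have h3 := expTail_anti h.integrable le_rfl hξ0
        have h4 := expTail_nonneg V a ξ
        have h5 : (δ⁻¹ * expTail V a ξ) ^ n / n.factorial ≤
            (δ⁻¹ * expTail V a 0) ^ n / n.factorial := by gcongr
        have h6 := h2.trans h5
        gcongr
      · exact ((integrableOn_exp_mul_norm h.integrable).mul_const _).const_mul _
    refine h1.congr fun k _ => ?_
    rw [jostIterate_succ, jostTransform_eq _ hx]

theorem jostFunction_eq (V : ℝ → ℂ) (k : ℂ) : jostFunction V k = jostAmplitude V k 0 := by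
  simp [jostFunction, jostSolution, jostAmplitude]

/-- The series converges uniformly where `-2 Im k < a - δ`, and these half-planes exhaust the domain
as `δ → 0`. -/
theorem ExpDecay.differentiableOn_jostFunction (h : ExpDecay V a) :
    DifferentiableOn ℂ (jostFunction V) {k : ℂ | -(2 * k.im) < a} := by
  intro k₀ hk₀
  simp only [mem_ofPred_eq] at hk₀
  obtain ⟨δ, hδ, hδa, hk⟩ : ∃ δ, 0 < δ ∧ δ ≤ a ∧ -(2 * k₀.im) < a - δ := by
    refine ⟨min a ((a + 2 * k₀.im) / 2), lt_min h.pos (by linarith), min_le_left _ _, ?_⟩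
    have := min_le_right a ((a + 2 * k₀.im) / 2)
    linarith
  have h1 : DifferentiableOn ℂ (fun k => ∑' n : ℕ, jostIterate V k n 0)
      {k : ℂ | -(2 * k.im) < a - δ} := by
    refine Complex.differentiableOn_tsum_of_summable_norm
      (KernelBound.hasSum_bound V δ⁻¹ a 0).summable
      (fun n => h.differentiableOn_jostIterate hδ hδa n 0 le_rfl) (isOpen_im_gt _) fun n k hk' => ?_
    exact ((h.kernelBound' hδ hδa (le_of_lt hk')).jostIterate_spec n).2 0 le_rfl
  have h2 := (h1 k₀ hk).differentiableAt ((isOpen_im_gt _).mem_nhds hk)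
  rw [show jostFunction V = fun k => ∑' n : ℕ, jostIterate V k n 0 from
    funext (jostFunction_eq V)]
  exact h2.differentiableWithinAt

theorem ExpDecay.analyticOnNhd_jostFunction (h : ExpDecay V a) :
    AnalyticOnNhd ℂ (jostFunction V) {k : ℂ | -(2 * k.im) < a} :=
  h.differentiableOn_jostFunction.analyticOnNhd (isOpen_im_gt _)

end

/-! ### Boundary terms at infinity and Green's identity -/

theorem not_integrableOn_of_eventually_one_le {f : ℝ → ℝ} (hf : ∀ᶠ x in atTop, 1 ≤ f x)
    (hint : IntegrableOn f (Ioi 0)) : False := by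
  obtain ⟨X, hX⟩ := eventually_atTop.1 hf
  have h1 : IntegrableOn (fun _ : ℝ => (1 : ℝ)) (Ioi (max X 0)) := by
    refine Integrable.mono' (hint.mono_set (Ioi_subset_Ioi (le_max_right X 0)))
      aestronglyMeasurable_const ((ae_restrict_iff' measurableSet_Ioi).2 (ae_of_all _ fun x hx => ?_))
    have hx' : max X 0 < x := hx
    simpa using hX x ((le_max_left X 0).trans hx'.le)
  rw [integrableOn_const_iff] at h1
  simp at h1

/-- If the Wronskian of a square integrable function and a function bounded together with its
derivative has a limit at infinity, then this limit is zero. -/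
theorem wronskian_limit_eq_zero {y z E Z : ℝ → ℂ} {C : ℝ} {w : ℂ} (hy : IsPrimitive y z)
    (hE : IsPrimitive E Z)
    (hEC : ∀ x, 0 ≤ x → ‖E x‖ ≤ C) (hZC : ∀ x, 0 ≤ x → ‖Z x‖ ≤ C)
    (hy2 : IntegrableOn (fun x => ‖y x‖ ^ 2) (Ioi 0))
    (hw : Tendsto (fun x => z x * E x - y x * Z x) atTop (𝓝 w)) : w = 0 := by
  by_contra hw0
  have hwpos : 0 < ‖w‖ := norm_pos_iff.2 hw0
  have hC : 0 ≤ C := (norm_nonneg _).trans (hEC 0 le_rfl)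
  obtain ⟨X, hX⟩ := eventually_atTop.1
    ((tendsto_iff_norm_sub_tendsto_zero.1 hw).eventually (gt_mem_nhds (show 0 < ‖w‖ / 4 by positivity)))
  set X₀ := max X 0 with hX₀
  have hX₀0 : 0 ≤ X₀ := le_max_right _ _
  have hprod := hy.mul hE
  set B := 4 * C ^ 2 / ‖w‖ with hB
  -- No decay of `y'` is known. But `(yE)' = zE + yZ` is the Wronskian plus `2yZ`, and the last term
  -- is split by completing a square, leaving an error integrable through `|y|²`.
  have hpt : ∀ t, X₀ ≤ t → ‖w - (z t * E t + y t * Z t)‖ ≤ ‖w‖ / 2 + B * ‖y t‖ ^ 2 := by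
    intro t ht
    have h1 := (hX t ((le_max_left _ _).trans ht)).le
    have h2 := hZC t (hX₀0.trans ht)
    have e1 : w - (z t * E t + y t * Z t) =
        -((z t * E t - y t * Z t) - w) - 2 * (y t * Z t) := by ring
    rw [e1]
    refine (norm_sub_le _ _).trans ?_
    rw [norm_neg, norm_mul, norm_mul, Complex.norm_ofNat]
    have h3 : 2 * (‖y t‖ * ‖Z t‖) ≤ 2 * (‖y t‖ * C) := by gcongr
    have h4 : 2 * (‖y t‖ * C) ≤ ‖w‖ / 4 + B * ‖y t‖ ^ 2 := by
      have h5 : ‖w‖ / 4 + B * ‖y t‖ ^ 2 - 2 * (‖y t‖ * C) =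
          (‖w‖ / 2 - 2 * C * ‖y t‖) ^ 2 / ‖w‖ := by
        rw [hB]; field_simp; ring
      have h6 : 0 ≤ (‖w‖ / 2 - 2 * C * ‖y t‖) ^ 2 / ‖w‖ := by positivity
      linarith
    linarith
  -- Integrating, a nonzero limit `w` would force `|y|` to grow linearly, contradicting square
  -- integrability.
  have hgrow : ∀ R, X₀ ≤ R → ‖w‖ / 2 * (R - X₀) - B * (∫ t in Ioi 0, ‖y t‖ ^ 2) -
      C * ‖y X₀‖ ≤ C * ‖y R‖ := by
    intro R hR
    have hR0 := hX₀0.trans hR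
    have hsub := hprod.sub_eq hX₀0 hR0
    have hi := hprod.intervalIntegrable hX₀0 hR0
    have hy2i : IntervalIntegrable (fun t => ‖y t‖ ^ 2) volume X₀ R := by
      rw [intervalIntegrable_iff_integrableOn_Ioc_of_le hR]
      exact hy2.mono_set (fun t ht => hX₀0.trans_lt ht.1)
    have h1 : ‖∫ t in X₀..R, (w - (z t * E t + y t * Z t))‖ ≤
        ∫ t in X₀..R, (‖w‖ / 2 + B * ‖y t‖ ^ 2) :=
      intervalIntegral.norm_integral_le_of_norm_le hR
        (ae_of_all _ fun t ht => hpt t ht.1.le) (intervalIntegrable_const.add (hy2i.const_mul B))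
    rw [intervalIntegral.integral_sub intervalIntegrable_const hi, ← hsub,
      intervalIntegral.integral_add intervalIntegrable_const (hy2i.const_mul B),
      intervalIntegral.integral_const_mul, intervalIntegral.integral_const,
      intervalIntegral.integral_const] at h1
    have h2 : ∫ t in X₀..R, ‖y t‖ ^ 2 ≤ ∫ t in Ioi 0, ‖y t‖ ^ 2 := by
      rw [intervalIntegral.integral_of_le hR]
      exact setIntegral_mono_set hy2 (ae_of_all _ fun _ => by positivity)
        (LE.le.eventuallyLE fun t ht => hX₀0.trans_lt ht.1)
    have hB0 : 0 ≤ B := by positivity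
    have h3 : ‖(R - X₀) • w‖ = (R - X₀) * ‖w‖ := by
      rw [norm_smul, Real.norm_of_nonneg (by linarith)]
    have h4 := norm_sub_norm_le ((R - X₀) • w) (y R * E R - y X₀ * E X₀)
    have h5 := norm_sub_le (y R * E R) (y X₀ * E X₀)
    have h6 : ‖y R * E R‖ ≤ C * ‖y R‖ := by
      rw [norm_mul, mul_comm]; gcongr; exact hEC R hR0
    have h7 : ‖y X₀ * E X₀‖ ≤ C * ‖y X₀‖ := by
      rw [norm_mul, mul_comm]; gcongr; exact hEC X₀ hX₀0
    have h8 := mul_le_mul_of_nonneg_left h2 hB0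
    simp only [smul_eq_mul] at h1
    rw [h3] at h4
    simp only [Complex.real_smul] at h1 h4
    linarith
  refine not_integrableOn_of_eventually_one_le ?_ hy2
  have hlin : Tendsto (fun R : ℝ => ‖w‖ / 2 * (R - X₀) - B * (∫ t in Ioi 0, ‖y t‖ ^ 2) -
      C * ‖y X₀‖) atTop atTop := by
    refine tendsto_atTop_add_const_right _ _ (tendsto_atTop_add_const_right _ _ ?_)
    exact (tendsto_atTop_add_const_right _ _ tendsto_id).const_mul_atTop (by positivity)
  filter_upwards [hlin.eventually_ge_atTop (C + 1), eventually_ge_atTop X₀] with R h1 h2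
  have h3 := hgrow R h2
  have h4 : 1 ≤ ‖y R‖ := by
    by_contra h5
    push Not at h5
    nlinarith
  exact one_le_pow₀ h4

theorem IsDirichletPair.exists_primitive {V : ℝ → ℂ} {u f : HalfLineL2}
    (h : IsDirichletPair V u f) : ∃ y z : ℝ → ℂ,
      (∀ᵐ x ∂(volume.restrict (Ioi (0 : ℝ))), u x = y x) ∧ y 0 = 0 ∧ IsPrimitive y z ∧
        IsPrimitive z (fun t => V t * y t - f t) := by
  obtain ⟨y, z, hu, h0, hd, hi, hz⟩ := h
  have hzp : IsPrimitive z (fun t => V t * y t - f t) := fun x hx =>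
    ⟨(hi x hx).sub (intervalIntegrable_coe f x hx), hz x hx⟩
  exact ⟨y, z, hu, h0, isPrimitive_of_hasDerivWithinAt hd hzp.continuousOn, hzp⟩

theorem integrableOn_sq_norm {u : HalfLineL2} {y : ℝ → ℂ}
    (hu : ∀ᵐ x ∂(volume.restrict (Ioi (0 : ℝ))), u x = y x) :
    IntegrableOn (fun x => ‖y x‖ ^ 2) (Ioi 0) := by
  have h1 : MemLp y 2 (volume.restrict (Ioi (0 : ℝ))) := (memLp_congr_ae hu).1 (Lp.memLp u)
  exact (memLp_two_iff_integrable_sq_norm h1.1).1 h1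

/-- The pairing `∫ u e(·, k)` of an `L²` function with the Jost solution. -/
noncomputable def jostPairing (V : ℝ → ℂ) (u : HalfLineL2) (k : ℂ) : ℂ :=
  ∫ x in Ioi (0 : ℝ), u x * jostSolution V x k

section Green

variable {V : ℝ → ℂ} {a : ℝ} {k : ℂ}

theorem ExpDecay.wronskian_isPrimitive (h : ExpDecay V a) (hk : 0 ≤ k.im) {y z f : ℝ → ℂ}
    (hy : IsPrimitive y z) (hz : IsPrimitive z (fun t => V t * y t - f t)) :
    IsPrimitive (fun x => z x * jostSolution V x k - y x * jostDeriv V k x)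
      (fun x => (k ^ 2 * y x - f x) * jostSolution V x k) := by
  refine ((hz.mul (h.isPrimitive_jostSolution hk)).sub
    (hy.mul (h.isPrimitive_jostDeriv hk))).congr (ae_of_all _ fun x => ?_)
  ring

theorem ExpDecay.exists_bound (h : ExpDecay V a) (hk : 0 ≤ k.im) : ∃ C : ℝ,
    (∀ x, 0 ≤ x → ‖jostSolution V x k‖ ≤ C) ∧ ∀ x, 0 ≤ x → ‖jostDeriv V k x‖ ≤ C := by
  obtain ⟨C, hC⟩ := h.exists_norm_jostDeriv_le hk
  refine ⟨max (Real.exp (a⁻¹ * expTail V a 0)) C, fun x hx => ?_,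
    fun x hx => (hC x hx).trans (le_max_right _ _)⟩
  have h1 : Real.exp (-(k.im * x)) ≤ 1 := Real.exp_le_one_iff.2 (by nlinarith)
  exact ((h.norm_jostSolution_le hk hx).trans
    (mul_le_of_le_one_right (Real.exp_pos _).le h1)).trans (le_max_left _ _)

theorem integrableOn_norm_mul_exp (u : HalfLineL2) {η : ℝ} (hη : 0 < η) (C : ℝ) :
    IntegrableOn (fun x => ‖u x‖ * (C * Real.exp (-(η * x)))) (Ioi 0) := by
  have h1 : MemLp (fun x : ℝ => C * Real.exp (-(η * x))) 2 (volume.restrict (Ioi (0 : ℝ))) := by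
    rw [memLp_two_iff_integrable_sq (Continuous.aestronglyMeasurable (by fun_prop))]
    refine ((integrableOn_exp_mul_Ioi (a := -(2 * η)) (by linarith) 0).const_mul (C ^ 2)).congr
      (ae_of_all _ fun x => ?_)
    simp only
    rw [mul_pow, ← Real.exp_nat_mul]
    congr 2
    push_cast
    ring
  exact (Lp.memLp u).norm.integrable_mul h1

theorem ExpDecay.norm_mul_jostSolution_le (h : ExpDecay V a) (u : HalfLineL2) {η : ℝ} (hη : 0 ≤ η)
    (hk : η ≤ k.im) {x : ℝ} (hx : 0 ≤ x) : ‖u x * jostSolution V x k‖ ≤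
      ‖u x‖ * (Real.exp (a⁻¹ * expTail V a 0) * Real.exp (-(η * x))) := by
  rw [norm_mul]
  gcongr
  refine (h.norm_jostSolution_le (hη.trans hk) hx).trans ?_
  gcongr

theorem ExpDecay.integrableOn_mul_jostSolution (h : ExpDecay V a) (u : HalfLineL2) (hk : 0 < k.im) :
    IntegrableOn (fun x => u x * jostSolution V x k) (Ioi 0) :=
  Integrable.mono' (integrableOn_norm_mul_exp u hk (Real.exp (a⁻¹ * expTail V a 0)))
    ((Lp.aestronglyMeasurable u).mul
      (((h.isPrimitive_jostSolution hk.le).continuousOn.mono Ioi_subset_Ici_self).aestronglyMeasurable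
        measurableSet_Ioi))
    ((ae_restrict_iff' measurableSet_Ioi).2 (ae_of_all _ fun _ hx =>
      h.norm_mul_jostSolution_le u hk.le le_rfl (le_of_lt hx)))

theorem ExpDecay.norm_jostPairing_le (h : ExpDecay V a) (u : HalfLineL2) {η : ℝ} (hη : 0 < η) :
    ∃ B : ℝ, ∀ k : ℂ, η ≤ k.im → ‖jostPairing V u k‖ ≤ B :=
  ⟨_, fun _ hk => norm_integral_le_of_norm_le
    (integrableOn_norm_mul_exp u hη (Real.exp (a⁻¹ * expTail V a 0)))
    ((ae_restrict_iff' measurableSet_Ioi).2 (ae_of_all _ fun _ hx =>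
      h.norm_mul_jostSolution_le u hη.le hk (le_of_lt hx)))⟩

theorem ExpDecay.eq_zero_of_cauchy (h : ExpDecay V a) {μ : ℂ} {y z : ℝ → ℂ}
    (hy : IsPrimitive y z) (hz : IsPrimitive z (fun t => V t * y t - μ * y t)) (hy0 : y 0 = 0)
    (hz0 : z 0 = 0) {x : ℝ} (hx : 0 ≤ x) : y x = 0 :=
  HalfLineSchrodinger.eq_zero_of_cauchy (q := fun t => V t - μ)
    (fun _ hx => (h.intervalIntegrable hx).sub intervalIntegrable_const) hy
    (hz.congr (ae_of_all _ fun t => by ring)) hy0 hz0 hx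

theorem eq_zero_of_ae {u : HalfLineL2} {y : ℝ → ℂ}
    (hu : ∀ᵐ x ∂(volume.restrict (Ioi (0 : ℝ))), u x = y x) (hy : ∀ x, 0 ≤ x → y x = 0) : u = 0 := by
  refine Lp.eq_zero_iff_ae_eq_zero.2 ?_
  filter_upwards [hu, ae_restrict_mem measurableSet_Ioi] with x h1 h2
  rw [h1, hy x (le_of_lt h2)]; rfl

theorem coe_smul_ae {μ : ℂ} {u : HalfLineL2} {y : ℝ → ℂ}
    (hu : ∀ᵐ x ∂(volume.restrict (Ioi (0 : ℝ))), u x = y x) :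
    ∀ᵐ x ∂(volume.restrict (Ioi (0 : ℝ))), (μ • u : HalfLineL2) x = μ * y x := by
  filter_upwards [hu, Lp.coeFn_smul μ u] with x h1 h2
  rw [h2, Pi.smul_apply, h1, smul_eq_mul]

/-- Green's identity against the Jost solutions: the constant `d` is the derivative at zero. -/
theorem ExpDecay.exists_green (h : ExpDecay V a) {u f : HalfLineL2} (huf : IsDirichletPair V u f) :
    ∃ d : ℂ, (∀ k : ℂ, 0 < k.im →
      jostPairing V f k = d * jostFunction V k + k ^ 2 * jostPairing V u k) ∧
        ∀ μ : ℂ, f = μ • u → d = 0 → u = 0 := by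
  obtain ⟨y, z, hu, hy0, hy, hz⟩ := huf.exists_primitive
  refine ⟨z 0, fun k hk => ?_, fun μ hf hd => ?_⟩
  · obtain ⟨C, hC1, hC2⟩ := h.exists_bound hk.le
    have hW := h.wronskian_isPrimitive hk.le hy hz
    have hi1 := h.integrableOn_mul_jostSolution f hk
    have hi2 := h.integrableOn_mul_jostSolution u hk
    have hae : ∀ᵐ x ∂(volume.restrict (Ioi (0 : ℝ))),
        k ^ 2 * (u x * jostSolution V x k) - f x * jostSolution V x k =
          (k ^ 2 * y x - f x) * jostSolution V x k := by
      filter_upwards [hu] with x hx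
      rw [hx]; ring
    have hi : IntegrableOn (fun x => (k ^ 2 * y x - f x) * jostSolution V x k) (Ioi 0) :=
      ((hi2.const_mul (k ^ 2)).sub hi1).congr hae
    have hval : ∫ x in Ioi 0, (k ^ 2 * y x - f x) * jostSolution V x k =
        k ^ 2 * jostPairing V u k - jostPairing V f k := by
      rw [← integral_congr_ae hae, integral_sub (hi2.const_mul _) hi1, integral_const_mul]
      rfl
    have hlim : Tendsto (fun x => z x * jostSolution V x k - y x * jostDeriv V k x) atTop
        (𝓝 (z 0 * jostSolution V 0 k - y 0 * jostDeriv V k 0 +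
          ∫ x in Ioi 0, (k ^ 2 * y x - f x) * jostSolution V x k)) := by
      refine ((intervalIntegral_tendsto_integral_Ioi 0 hi tendsto_id).const_add _).congr' ?_
      filter_upwards [eventually_ge_atTop 0] with x hx
      exact (hW x hx).2.symm
    have h0 := wronskian_limit_eq_zero hy (h.isPrimitive_jostSolution hk.le) hC1
      hC2 (integrableOn_sq_norm hu) hlim
    rw [hval, hy0] at h0
    rw [jostFunction]
    linear_combination -h0
  · subst hf
    refine eq_zero_of_ae hu fun x hx => h.eq_zero_of_cauchy (μ := μ) hy (hz.congr ?_) hy0 hd hx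
    filter_upwards [coe_smul_ae (μ := μ) hu] with x hx
    rw [hx]

/-- There are no eigenvalues on the half-line `[0, ∞)`. -/
theorem ExpDecay.eq_zero_of_real (h : ExpDecay V a) (hk : k.im = 0) {u : HalfLineL2}
    (huf : IsDirichletPair V u (k ^ 2 • u)) : u = 0 := by
  obtain ⟨y, z, hu, hy0, hy, hz⟩ := huf.exists_primitive
  have hz' : IsPrimitive z (fun t => V t * y t - k ^ 2 * y t) := by
    refine hz.congr ?_
    filter_upwards [coe_smul_ae (μ := k ^ 2) hu] with x hx
    rw [hx]
  obtain ⟨C, hC1, hC2⟩ := h.exists_bound hk.ge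
  have hW := h.wronskian_isPrimitive hk.ge hy hz'
  have hconst : ∀ x, 0 ≤ x → z x * jostSolution V x k - y x * jostDeriv V k x =
      z 0 * jostSolution V 0 k := by
    intro x hx
    have := (hW x hx).2
    simpa [hy0] using this
  have hW0 : z 0 * jostSolution V 0 k = 0 := by
    refine wronskian_limit_eq_zero hy (h.isPrimitive_jostSolution hk.ge) hC1
      hC2 (integrableOn_sq_norm hu)
      (tendsto_const_nhds.congr' ?_)
    filter_upwards [eventually_ge_atTop 0] with x hx
    exact (hconst x hx).symm
  by_cases hz0 : z 0 = 0
  · exact eq_zero_of_ae hu fun x hx => h.eq_zero_of_cauchy hy hz' hy0 hz0 hx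
  exfalso
  have hE0 : jostSolution V 0 k = 0 := (mul_eq_zero.1 hW0).resolve_left hz0
  -- This combination solves the equation with zero Cauchy data. So the Jost solution is a multiple
  -- of `y`, which is impossible since its modulus tends to 1 for real `k`.
  have hprop : ∀ x, 0 ≤ x →
      jostDeriv V k 0 * y x - z 0 * jostSolution V x k = 0 := by
    intro x hx
    refine h.eq_zero_of_cauchy (μ := k ^ 2)
      (y := fun x => jostDeriv V k 0 * y x - z 0 * jostSolution V x k)
      (z := fun x => jostDeriv V k 0 * z x - z 0 * jostDeriv V k x)
      ((hy.const_mul _).sub ((h.isPrimitive_jostSolution hk.ge).const_mul _))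
      ((((hz'.const_mul _).sub ((h.isPrimitive_jostDeriv hk.ge).const_mul _))).congr
        (ae_of_all _ fun t => by ring)) (by simp [hy0, hE0]) (by ring) hx
  have hlim : Tendsto (fun x => ‖jostSolution V x k‖) atTop (𝓝 1) := by
    have h1 := (h.tendsto_jostAmplitude hk.ge).norm
    rw [norm_one] at h1
    refine h1.congr fun x => ?_
    rw [jostSolution_eq, norm_mul, norm_exp_I_mul, hk]
    simp
  have hint : IntegrableOn (fun x => ‖z 0‖⁻¹ ^ 2 * ‖jostDeriv V k 0‖ ^ 2 * 4 * ‖y x‖ ^ 2) (Ioi 0) :=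
    (integrableOn_sq_norm hu).const_mul _
  refine not_integrableOn_of_eventually_one_le ?_ hint
  filter_upwards [hlim.eventually (lt_mem_nhds (show (1 / 2 : ℝ) < 1 by norm_num)),
    eventually_ge_atTop 0] with x h1 h2
  have h3 := congrArg norm (sub_eq_zero.1 (hprop x h2))
  rw [norm_mul, norm_mul] at h3
  have hpos : 0 < ‖z 0‖ := norm_pos_iff.2 hz0
  have h4 : ‖z 0‖⁻¹ ^ 2 * ‖jostDeriv V k 0‖ ^ 2 * 4 * ‖y x‖ ^ 2 =
      ‖z 0‖⁻¹ ^ 2 * 4 * (‖jostDeriv V k 0‖ * ‖y x‖) ^ 2 := by ring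
  rw [h4, h3]
  have h5 : ‖z 0‖⁻¹ ^ 2 * 4 * (‖z 0‖ * ‖jostSolution V x k‖) ^ 2 =
      4 * ‖jostSolution V x k‖ ^ 2 := by field_simp
  rw [h5]
  nlinarith

end Green

/-! ### Algebraic multiplicity and the order of the zero -/

theorem natCast_le_analyticOrderAt_of_isBigO {f : ℂ → ℂ} {z₀ : ℂ} (hf : AnalyticAt ℂ f z₀) {n : ℕ}
    (h : f =O[𝓝 z₀] fun z => (z - z₀) ^ n) : (n : ℕ∞) ≤ analyticOrderAt f z₀ := by
  by_contra hlt
  push Not at hlt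
  obtain ⟨m, hm⟩ := ENat.ne_top_iff_exists.1 hlt.ne_top
  rw [← hm, Nat.cast_lt] at hlt
  obtain ⟨g, hg, hg0, hfg⟩ := (hf.analyticOrderAt_eq_natCast).1 hm.symm
  obtain ⟨C, hC⟩ := h.bound
  have hlim : Tendsto (fun z => ‖g z‖) (𝓝[≠] z₀) (𝓝 ‖g z₀‖) :=
    (hg.continuousAt.norm).mono_left nhdsWithin_le_nhds
  have hlim2 : Tendsto (fun z => C * ‖z - z₀‖ ^ (n - m)) (𝓝[≠] z₀) (𝓝 0) := by
    have hc : Continuous fun z : ℂ => C * ‖z - z₀‖ ^ (n - m) := by fun_prop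
    have h1 := (hc.tendsto z₀).mono_left (nhdsWithin_le_nhds (s := {z₀}ᶜ))
    simpa [zero_pow (Nat.sub_ne_zero_of_lt hlt)] using h1
  have hle : ‖g z₀‖ ≤ 0 := by
    refine le_of_tendsto_of_tendsto hlim hlim2 ?_
    filter_upwards [hfg.filter_mono nhdsWithin_le_nhds, hC.filter_mono nhdsWithin_le_nhds,
      self_mem_nhdsWithin] with z h1 h2 h3
    have hpos : 0 < ‖z - z₀‖ := norm_pos_iff.2 (sub_ne_zero.2 h3)
    rw [h1, norm_smul, norm_pow, norm_pow] at h2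
    have e1 : ‖z - z₀‖ ^ n = ‖z - z₀‖ ^ m * ‖z - z₀‖ ^ (n - m) := by
      rw [← pow_add, Nat.add_sub_cancel' hlt.le]
    rw [e1] at h2
    refine le_of_mul_le_mul_left (h2.trans (le_of_eq ?_)) (pow_pos hpos m)
    ring
  exact hg0 (norm_le_zero_iff.1 hle)

section

variable {V : ℝ → ℂ} {a : ℝ} {μ k : ℂ}

theorem mem_powKer_succ {n : ℕ} {u : HalfLineL2} :
    u ∈ powKer (schrodingerOperator V) μ (n + 1) ↔
      ∃ f, IsDirichletPair V u f ∧ f - μ • u ∈ powKer (schrodingerOperator V) μ n := by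
  constructor
  · rintro ⟨x, hx, rfl⟩
    refine ⟨schrodingerOperator V x, ?_, hx⟩
    have h1 : ((x : HalfLineL2), schrodingerOperator V x) ∈ (schrodingerOperator V).graph :=
      LinearPMap.mem_graph _ x
    rw [schrodingerOperator_graph] at h1
    exact h1
  · rintro ⟨f, huf, hf⟩
    have h1 : (u, f) ∈ (schrodingerOperator V).graph := by
      rw [schrodingerOperator_graph]; exact huf
    obtain ⟨x, hx1, hx2⟩ := (LinearPMap.mem_graph_iff _).1 h1
    simp only at hx1 hx2
    subst hx1 hx2
    exact ⟨x, hf, rfl⟩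

theorem powKer_le_succ {H : Type*} [AddCommGroup H] [Module ℂ H] (T : H →ₗ.[ℂ] H) (μ : ℂ) (n : ℕ) :
    powKer T μ n ≤ powKer T μ (n + 1) := by
  induction n with
  | zero => exact bot_le
  | succ n ih => exact Submodule.map_mono (Submodule.comap_mono ih)

theorem ExpDecay.jostPairing_sub_smul (h : ExpDecay V a) (hk : 0 < k.im) (f u : HalfLineL2) :
    jostPairing V (f - μ • u) k = jostPairing V f k - μ * jostPairing V u k := by
  rw [jostPairing, jostPairing, jostPairing, ← integral_const_mul,
    ← integral_sub (h.integrableOn_mul_jostSolution f hk)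
      ((h.integrableOn_mul_jostSolution u hk).const_mul μ)]
  refine integral_congr_ae ?_
  filter_upwards [Lp.coeFn_sub f (μ • u), Lp.coeFn_smul μ u] with x h1 h2
  rw [h1, Pi.sub_apply, h2, Pi.smul_apply, smul_eq_mul]
  ring

/-- A root vector of height `n + 1` forces the Jost function to vanish to order `n + 1`. -/
theorem ExpDecay.exists_factor (h : ExpDecay V a) (n : ℕ) : ∀ u : HalfLineL2,
    u ∈ powKer (schrodingerOperator V) μ (n + 1) → u ∉ powKer (schrodingerOperator V) μ n →
      ∃ p : ℂ → ℂ, Continuous p ∧ p μ ≠ 0 ∧ ∀ k : ℂ, 0 < k.im →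
        (k ^ 2 - μ) ^ (n + 1) * jostPairing V u k = jostFunction V k * p (k ^ 2) := by
  induction n with
  | zero =>
    intro u hu hu0
    obtain ⟨f, huf, hf⟩ := mem_powKer_succ.1 hu
    obtain ⟨d, hd, hd0⟩ := h.exists_green huf
    have hf' : f = μ • u := sub_eq_zero.1 ((Submodule.mem_bot ℂ).1 hf)
    refine ⟨fun _ => -d, continuous_const, fun h0 => hu0 ?_, fun k hk => ?_⟩
    · exact (Submodule.mem_bot ℂ).2 (hd0 μ hf' (neg_eq_zero.1 h0))
    · have h1 := hd k hk
      have h2 := h.jostPairing_sub_smul (μ := μ) hk f u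
      rw [sub_eq_zero.2 hf'] at h2
      have h3 : jostPairing V (0 : HalfLineL2) k = 0 := by
        rw [jostPairing, integral_eq_zero_of_ae]
        filter_upwards [Lp.coeFn_zero ℂ 2 (volume.restrict (Ioi (0 : ℝ)))] with x hx
        rw [hx]; simp
      rw [h3] at h2
      rw [zero_add, pow_one]
      linear_combination -h1 - h2
  | succ n ih =>
    intro u hu hu0
    obtain ⟨f, huf, hf⟩ := mem_powKer_succ.1 hu
    obtain ⟨d, hd, -⟩ := h.exists_green huf
    obtain ⟨p, hpc, hp0, hp⟩ := ih (f - μ • u) hf fun hf' => hu0 (mem_powKer_succ.2 ⟨f, huf, hf'⟩)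
    -- The correction from Green's identity vanishes at `μ`, so the value of `p` there is inherited
    -- from the bottom of the chain.
    refine ⟨fun s => p s - d * (s - μ) ^ (n + 1), by fun_prop, by simpa using hp0, fun k hk => ?_⟩
    have h1 := hd k hk
    have h2 := h.jostPairing_sub_smul (μ := μ) hk f u
    have h3 := hp k hk
    rw [h2] at h3
    linear_combination h3 - (k ^ 2 - μ) ^ (n + 1) * h1

/-- Near `k` the factor `p(w²)` stays away from zero while the pairing and `w + k` stay bounded, so
the factorization gives `e(w) = O((w - k)^(n+1))`. Holomorphy of the pairing is not needed. -/
theorem ExpDecay.le_analyticOrderAt (h : ExpDecay V a) (hk : 0 < k.im) {n : ℕ} {u : HalfLineL2}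
    (hu : u ∈ powKer (schrodingerOperator V) (k ^ 2) (n + 1))
    (hu0 : u ∉ powKer (schrodingerOperator V) (k ^ 2) n) :
    ((n + 1 : ℕ) : ℕ∞) ≤ analyticOrderAt (jostFunction V) k := by
  obtain ⟨p, hpc, hp0, hp⟩ := h.exists_factor n u hu hu0
  obtain ⟨B, hB⟩ := h.norm_jostPairing_le u (half_pos hk)
  have hB0 : 0 ≤ B := (norm_nonneg _).trans (hB k (by linarith))
  refine natCast_le_analyticOrderAt_of_isBigO
    (h.analyticOnNhd_jostFunction k (show -(2 * k.im) < a by linarith [h.pos])) ?_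
  have hppos : 0 < ‖p (k ^ 2)‖ := norm_pos_iff.2 hp0
  refine Asymptotics.IsBigO.of_bound
    ((2 * ‖k‖ + 1) ^ (n + 1) * B / (‖p (k ^ 2)‖ / 2)) ?_
  have e1 : ∀ᶠ w : ℂ in 𝓝 k, ‖p (k ^ 2)‖ / 2 < ‖p (w ^ 2)‖ := by
    have hc : Continuous fun w : ℂ => ‖p (w ^ 2)‖ := by fun_prop
    exact (hc.tendsto k).eventually (lt_mem_nhds (half_lt_self hppos))
  have e2 : ∀ᶠ w : ℂ in 𝓝 k, k.im / 2 < w.im :=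
    (Complex.continuous_im.tendsto k).eventually (lt_mem_nhds (half_lt_self hk))
  have e3 : ∀ᶠ w : ℂ in 𝓝 k, ‖w + k‖ < 2 * ‖k‖ + 1 := by
    have hc : Continuous fun w : ℂ => ‖w + k‖ := by fun_prop
    refine (hc.tendsto k).eventually (gt_mem_nhds ?_)
    linarith [norm_add_le k k]
  filter_upwards [e1, e2, e3] with w h1 h2 h3
  have h4 := congrArg norm (hp w (by linarith))
  have h5 := hB w h2.le
  rw [show w ^ 2 - k ^ 2 = (w + k) * (w - k) by ring, mul_pow, norm_mul, norm_mul, norm_mul,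
    norm_pow, norm_pow] at h4
  rw [norm_pow, div_mul_eq_mul_div, le_div_iff₀ (by positivity)]
  calc ‖jostFunction V w‖ * (‖p (k ^ 2)‖ / 2) ≤ ‖jostFunction V w‖ * ‖p (w ^ 2)‖ := by gcongr
    _ = ‖w + k‖ ^ (n + 1) * ‖w - k‖ ^ (n + 1) * ‖jostPairing V u w‖ := h4.symm
    _ ≤ (2 * ‖k‖ + 1) ^ (n + 1) * ‖w - k‖ ^ (n + 1) * B := by gcongr
    _ = _ := by ring

/-- Eigenfunctions for the same eigenvalue are proportional. -/
theorem ExpDecay.exists_eq_smul (h : ExpDecay V a) {u v : HalfLineL2}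
    (hu : IsDirichletPair V u (μ • u)) (hv : IsDirichletPair V v (μ • v)) (hu0 : u ≠ 0) :
    ∃ c : ℂ, c • u = v := by
  obtain ⟨y₁, z₁, hu₁, h0₁, hy₁, hz₁⟩ := hu.exists_primitive
  obtain ⟨y₂, z₂, hu₂, h0₂, hy₂, hz₂⟩ := hv.exists_primitive
  have hz₁' : IsPrimitive z₁ (fun t => V t * y₁ t - μ * y₁ t) := by
    refine hz₁.congr ?_
    filter_upwards [coe_smul_ae (μ := μ) hu₁] with x hx
    rw [hx]
  have hz₂' : IsPrimitive z₂ (fun t => V t * y₂ t - μ * y₂ t) := by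
    refine hz₂.congr ?_
    filter_upwards [coe_smul_ae (μ := μ) hu₂] with x hx
    rw [hx]
  have hd : z₁ 0 ≠ 0 := fun h0 =>
    hu0 (eq_zero_of_ae hu₁ fun x hx => h.eq_zero_of_cauchy hy₁ hz₁' h0₁ h0 hx)
  refine ⟨z₂ 0 / z₁ 0, sub_eq_zero.1 (eq_zero_of_ae (y := fun x => z₂ 0 / z₁ 0 * y₁ x - y₂ x) ?_
    fun x hx => ?_)⟩
  · filter_upwards [Lp.coeFn_sub ((z₂ 0 / z₁ 0) • u) v, Lp.coeFn_smul (z₂ 0 / z₁ 0) u, hu₁, hu₂]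
      with x h1 h2 h3 h4
    rw [h1, Pi.sub_apply, h2, Pi.smul_apply, h3, h4, smul_eq_mul]
  · refine h.eq_zero_of_cauchy (μ := μ) (z := fun x => z₂ 0 / z₁ 0 * z₁ x - z₂ x)
      ((hy₁.const_mul _).sub hy₂) (((hz₁'.const_mul _).sub hz₂').congr
        (ae_of_all _ fun t => by ring)) (by simp [h0₁, h0₂]) ?_ hx
    field_simp
    ring

/-- Rank-nullity for `T - μ` from each kernel to the preceding one: its null space consists of
eigenvectors and has dimension at most one. -/
theorem rank_powKer_le {H : Type*} [AddCommGroup H] [Module ℂ H] (T : H →ₗ.[ℂ] H) (μ : ℂ)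
    (hone : ∀ x y : T.domain, T x = μ • (x : H) → T y = μ • (y : H) → (x : H) ≠ 0 →
      ∃ c : ℂ, c • (x : H) = y) (n : ℕ) : Module.rank ℂ (powKer T μ n) ≤ n := by
  induction n with
  | zero =>
    change Module.rank ℂ (⊥ : Submodule ℂ H) ≤ _
    simp
  | succ n ih =>
    set S : Submodule ℂ T.domain := (powKer T μ n).comap (T.toFun - μ • T.domain.subtype)
    have h1 : Module.rank ℂ (powKer T μ (n + 1)) ≤ Module.rank ℂ S := by
      rw [powKer]
      exact rank_map_le _ _
    let φ : S →ₗ[ℂ] powKer T μ n :=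
      (T.toFun - μ • T.domain.subtype).restrict (p := S) (q := powKer T μ n) fun x hx => hx
    have h2 : Module.rank ℂ (LinearMap.range φ) ≤ n := (Submodule.rank_le _).trans ih
    have hker : ∀ v : LinearMap.ker φ, T ((v : S) : T.domain) = μ • (((v : S) : T.domain) : H) := by
      intro v
      have hv : φ v = 0 := v.2
      exact sub_eq_zero.1 (congrArg Subtype.val hv)
    have h3 : Module.rank ℂ (LinearMap.ker φ) ≤ 1 := by
      obtain ⟨v, hv⟩ : ∃ v : S, LinearMap.ker φ ≤ Submodule.span ℂ {v} := by
        by_cases hex : ∃ v : LinearMap.ker φ, (((v : S) : T.domain) : H) ≠ 0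
        · obtain ⟨v, hv⟩ := hex
          refine ⟨v, fun w hw => Submodule.mem_span_singleton.2 ?_⟩
          obtain ⟨c, hc⟩ := hone _ _ (hker v) (hker ⟨w, hw⟩) hv
          exact ⟨c, Subtype.ext (Subtype.ext hc)⟩
        · push Not at hex
          refine ⟨0, fun w hw => ?_⟩
          have hw0 : w = 0 := Subtype.ext (Subtype.ext (hex ⟨w, hw⟩))
          rw [hw0]
          exact Submodule.zero_mem _
      refine (Submodule.rank_mono hv).trans ((rank_span_le _).trans ?_)
      rw [Cardinal.mk_singleton]
    rw [← LinearMap.rank_range_add_rank_ker φ] at h1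
    push_cast
    exact h1.trans (add_le_add h2 h3)

theorem isDirichletPair_apply (x : (schrodingerOperator V).domain) :
    IsDirichletPair V x (schrodingerOperator V x) :=
  (schrodingerOperator_graph V).le (LinearPMap.mem_graph _ x)

theorem ExpDecay.rank_powKer_le (h : ExpDecay V a) (n : ℕ) :
    Module.rank ℂ (powKer (schrodingerOperator V) μ n) ≤ n := by
  refine HalfLineSchrodinger.rank_powKer_le _ μ (fun x y hx hy hx0 => ?_) n
  exact h.exists_eq_smul (hx ▸ isDirichletPair_apply x) (hy ▸ isDirichletPair_apply y) hx0

theorem ExpDecay.algMultiplicity_le (h : ExpDecay V a) (hk : 0 < k.im) :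
    algMultiplicity (schrodingerOperator V) (k ^ 2) ≤ analyticOrderAt (jostFunction V) k := by
  rcases eq_or_ne (analyticOrderAt (jostFunction V) k) ⊤ with htop | htop
  · rw [htop]; exact le_top
  obtain ⟨m, hm⟩ := ENat.ne_top_iff_exists.1 htop
  -- The chain of kernels is constant from `m` on, since a new vector of height `n + 1 > m` would
  -- make the zero's order exceed `m`.
  have hle : ∀ n, powKer (schrodingerOperator V) (k ^ 2) n ≤
      powKer (schrodingerOperator V) (k ^ 2) m := by
    intro n
    rcases le_total n m with hnm | hnm
    · exact monotone_nat_of_le_succ (powKer_le_succ _ _) hnm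
    · induction n, hnm using Nat.le_induction with
      | base => exact le_rfl
      | succ n hmn ih =>
        refine le_trans (fun u hu => ?_) ih
        by_contra hu0
        have h1 := h.le_analyticOrderAt hk hu hu0
        rw [← hm, Nat.cast_le] at h1
        omega
  rw [← hm, algMultiplicity, Cardinal.toENat_le_natCast]
  exact (Submodule.rank_mono (iSup_le hle)).trans (h.rank_powKer_le m)

theorem ExpDecay.algMultiplicity_eq_zero (h : ExpDecay V a) (hk : k.im = 0) :
    algMultiplicity (schrodingerOperator V) (k ^ 2) = 0 := by
  have hbot : ∀ n, powKer (schrodingerOperator V) (k ^ 2) n = ⊥ := by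
    intro n
    induction n with
    | zero => rfl
    | succ n ih =>
      rw [eq_bot_iff]
      intro u hu
      obtain ⟨f, huf, hf⟩ := mem_powKer_succ.1 hu
      rw [ih, Submodule.mem_bot, sub_eq_zero] at hf
      rw [hf] at huf
      exact (Submodule.mem_bot ℂ).2 (h.eq_zero_of_real hk huf)
  have hroot : rootSpace (schrodingerOperator V) (k ^ 2) = ⊥ := by
    simp [rootSpace, hbot]
  rw [algMultiplicity, hroot]
  simp

end

/-! ### Counting zeros by Jensen's inequality -/

/-- The order of the zero `k` of the Jost function, counted only in the closed upper half-plane. -/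
noncomputable def upperOrder (V : ℝ → ℂ) (k : ℂ) : ℝ≥0∞ :=
  if 0 ≤ k.im then (analyticOrderAt (jostFunction V) k : ℝ≥0∞) else 0

theorem exists_sqrt_im_nonneg (μ : ℂ) : ∃ k : ℂ, k ^ 2 = μ ∧ 0 ≤ k.im := by
  obtain ⟨z, hz⟩ := IsAlgClosed.exists_pow_nat_eq μ (n := 2) (by norm_num)
  rcases le_total 0 z.im with h | h
  · exact ⟨z, hz, h⟩
  · exact ⟨-z, by rw [neg_sq, hz], by simpa using h⟩

section

variable {V : ℝ → ℂ} {a b : ℝ}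

/-- Choosing the square root with nonnegative imaginary part injects eigenvalues into the open upper
half-plane: a real root contributes zero multiplicity. Spectral singularities occupy the real axis,
so the two counts do not overlap. -/
theorem ExpDecay.totalMultiplicity_le_tsum (h : ExpDecay V a) :
    totalMultiplicity V ≤ ∑' k : ℂ, upperOrder V k := by
  choose s hs hs0 using exists_sqrt_im_nonneg
  have hinj : Function.Injective s := fun x y hxy => by rw [← hs x, ← hs y, hxy]
  set g₁ : ℂ → ℝ≥0∞ := fun k => if 0 < k.im then (analyticOrderAt (jostFunction V) k : ℝ≥0∞) else 0
    with hg₁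
  set g₂ : ℂ → ℝ≥0∞ := fun k => if k.im = 0 then (analyticOrderAt (jostFunction V) k : ℝ≥0∞) else 0
    with hg₂
  have hsplit : ∀ k, upperOrder V k = g₁ k + g₂ k := by
    intro k
    rcases lt_trichotomy 0 k.im with hk | hk | hk
    · simp [upperOrder, hg₁, hg₂, hk, hk.le, hk.ne']
    · simp [upperOrder, hg₁, hg₂, ← hk]
    · simp [upperOrder, hg₁, hg₂, hk.ne, not_le.2 hk, not_lt.2 hk.le]
  rw [tsum_congr hsplit, ENNReal.tsum_add, totalMultiplicity]
  refine add_le_add ?_ ?_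
  · refine le_trans (ENNReal.tsum_le_tsum fun μ => ?_)
      (ENNReal.tsum_comp_le_tsum_of_injective hinj g₁)
    rcases (hs0 μ).lt_or_eq with hk | hk
    · simp only [hg₁, if_pos hk]
      rw [ENat.toENNReal_le]
      conv_lhs => rw [← hs μ]
      exact h.algMultiplicity_le hk
    · have h0 := h.algMultiplicity_eq_zero hk.symm
      rw [hs μ] at h0
      simp [h0]
  · refine le_trans (ENNReal.tsum_le_tsum fun k => ?_)
      (ENNReal.tsum_comp_le_tsum_of_injective Complex.ofReal_injective g₂)
    simp [hg₂]

theorem ExpDecay.kernelBound_of_ne_zero (h : ExpDecay V a) {k : ℂ} {τ : ℝ} (hk : k ≠ 0) (hτ : 0 ≤ τ)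
    (hτa : τ ≤ a) (hkτ : -(2 * k.im) ≤ τ) : KernelBound V k ‖k‖⁻¹ τ :=
  ⟨by positivity, hτ, fun _ ht => norm_jostKernel_le_div hk hτ hkτ ht,
    integrableOn_exp_mul_of_le hτa h.integrable⟩

theorem expTail_zero_zero (V : ℝ → ℂ) : expTail V 0 0 = ∫ x in Ioi (0 : ℝ), ‖V x‖ := by
  simp [expTail]

theorem ExpDecay.norm_jostFunction_sub_one_le (h : ExpDecay V a) {k : ℂ} (hk : k ≠ 0)
    (hk0 : 0 ≤ k.im) :
    ‖jostFunction V k - 1‖ ≤ Real.exp (‖k‖⁻¹ * ∫ x in Ioi (0 : ℝ), ‖V x‖) - 1 := by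
  rw [jostFunction_eq, ← expTail_zero_zero]
  exact (h.kernelBound_of_ne_zero hk le_rfl h.pos.le
    (by linarith)).norm_jostAmplitude_sub_one_le le_rfl

/-- The zeros of the Jost function in the closed upper half-plane lie in the disc of radius `b`. -/
theorem ExpDecay.norm_le_of_jostFunction_eq_zero (h : ExpDecay V a) (hb : 0 < b)
    (hbV : ∫ x in Ioi (0 : ℝ), ‖V x‖ = b * Real.log 2) {k : ℂ} (hk0 : 0 ≤ k.im)
    (hk : jostFunction V k = 0) : ‖k‖ ≤ b := by
  by_contra hlt
  push Not at hlt
  have hpos : 0 < ‖k‖ := hb.trans hlt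
  have h1 := h.norm_jostFunction_sub_one_le (norm_pos_iff.1 hpos) hk0
  rw [hk, zero_sub, norm_neg, norm_one, hbV] at h1
  have hlog : 0 < Real.log 2 := Real.log_pos (by norm_num)
  have h2 : ‖k‖⁻¹ * (b * Real.log 2) < Real.log 2 := by
    rw [← mul_assoc]
    refine mul_lt_of_lt_one_left hlog ?_
    rw [inv_mul_eq_div, div_lt_one hpos]
    exact hlt
  have h3 := Real.exp_lt_exp.2 h2
  rw [Real.exp_log (by norm_num)] at h3
  linarith

/-- At distance `2b` from the origin the deviation from 1 is at most `√2 - 1`, which is below `1/2`.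
-/
theorem ExpDecay.half_le_norm_jostFunction (h : ExpDecay V a) (hb : 0 < b)
    (hbV : ∫ x in Ioi (0 : ℝ), ‖V x‖ = b * Real.log 2) :
    1 / 2 ≤ ‖jostFunction V ((2 * b : ℝ) * Complex.I)‖ := by
  have hk : ((2 * b : ℝ) : ℂ) * Complex.I ≠ 0 :=
    mul_ne_zero (Complex.ofReal_ne_zero.2 (by positivity)) Complex.I_ne_zero
  have h1 := h.norm_jostFunction_sub_one_le hk (by simp [hb.le])
  have hn : ‖((2 * b : ℝ) : ℂ) * Complex.I‖ = 2 * b := by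
    rw [norm_mul, Complex.norm_I, mul_one, Complex.norm_real, Real.norm_of_nonneg (by positivity)]
  rw [hn, hbV, show (2 * b)⁻¹ * (b * Real.log 2) = Real.log 2 / 2 by field_simp] at h1
  have h2 : Real.exp (Real.log 2 / 2) ≤ 3 / 2 := by
    have h3 : Real.exp (Real.log 2 / 2) ^ 2 = 2 := by
      rw [← Real.exp_nat_mul]
      push_cast
      rw [mul_div_cancel₀ _ (by norm_num), Real.exp_log (by norm_num)]
    nlinarith [Real.exp_pos (Real.log 2 / 2)]
  have h4 := norm_sub_norm_le (1 : ℂ) (1 - jostFunction V ((2 * b : ℝ) * Complex.I))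
  rw [sub_sub_cancel, norm_one, norm_sub_rev] at h4
  linarith

/-- The radius `2.49 b` leaves `|k| ≥ 0.49 b` and `-2 Im k ≤ 0.98 b`. Staying below `2.5 b` keeps
the closed disc inside the domain of holomorphy even when `a = b`. -/
theorem ExpDecay.norm_jostFunction_le_on_sphere (h : ExpDecay V a) (hb : 0 < b) (hba : b ≤ a) {k : ℂ}
    (hk : k ∈ Metric.sphere (((2 * b : ℝ) : ℂ) * Complex.I) (249 / 100 * b)) :
    ‖jostFunction V k‖ ≤ Real.exp (expTail V b 0 / (49 / 100 * b)) := by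
  rw [mem_sphere_iff_norm] at hk
  have hn : ‖((2 * b : ℝ) : ℂ) * Complex.I‖ = 2 * b := by
    rw [norm_mul, Complex.norm_I, mul_one, Complex.norm_real, Real.norm_of_nonneg (by positivity)]
  have h1 : 49 / 100 * b ≤ ‖k‖ := by
    have := norm_sub_le k (((2 * b : ℝ) : ℂ) * Complex.I)
    rw [hk, hn] at this
    linarith
  have h2 : -(2 * k.im) ≤ b := by
    have := Complex.abs_im_le_norm (k - ((2 * b : ℝ) : ℂ) * Complex.I)
    rw [hk] at this
    have h3 : (k - ((2 * b : ℝ) : ℂ) * Complex.I).im = k.im - 2 * b := by simp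
    rw [h3] at this
    linarith [neg_abs_le (k.im - 2 * b)]
  have hk0 : k ≠ 0 := norm_pos_iff.1 (lt_of_lt_of_le (by positivity) h1)
  rw [jostFunction_eq]
  refine ((h.kernelBound_of_ne_zero hk0 hb.le hba h2).norm_jostAmplitude_le le_rfl).trans ?_
  refine Real.exp_le_exp.2 ?_
  rw [inv_mul_eq_div]
  exact div_le_div_of_nonneg_left (expTail_nonneg V b 0) (by positivity) h1

theorem log_radius_ratio_ge : (21 / 200 : ℝ) ≤ Real.log (249 / 100 / √5) := by
  have h5 : (0 : ℝ) < √5 := by positivity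
  rw [Real.le_log_iff_exp_le (by positivity), le_div_iff₀ h5]
  have h1 : Real.exp (21 / 200) ≤ (200 / 193) ^ 3 := by
    -- From `1 + x ≤ e^x` at `x = -7/200`; cubing it is sharp enough, whereas `x = -21/200` would
    -- not be.
    have h2 : Real.exp (7 / 200) ≤ 200 / 193 := by
      have h3 := Real.add_one_le_exp (-(7 / 200) : ℝ)
      rw [Real.exp_neg] at h3
      have h4 : (193 / 200 : ℝ) ≤ (Real.exp (7 / 200))⁻¹ := by linarith
      have h6 := inv_anti₀ (by norm_num) h4
      rw [inv_inv] at h6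
      linarith
    have h7 : Real.exp (21 / 200) = Real.exp (7 / 200) ^ 3 := by
      rw [← Real.exp_nat_mul]; norm_num
    rw [h7]
    gcongr
  have h8 : √5 ≤ 2.2361 := by
    rw [Real.sqrt_le_left (by norm_num)]; norm_num
  calc Real.exp (21 / 200) * √5 ≤ (200 / 193) ^ 3 * 2.2361 := by gcongr
    _ ≤ 249 / 100 := by norm_num

theorem ExpDecay.tsum_upperOrder_le (h : ExpDecay V a) (hb : 0 < b) (hba : b ≤ a)
    (hbV : ∫ x in Ioi (0 : ℝ), ‖V x‖ = b * Real.log 2) :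
    ∑' k : ℂ, upperOrder V k ≤ ENNReal.ofReal (10 * (1 + (2 / b) * expTail V b 0)) := by
  set c : ℂ := ((2 * b : ℝ) : ℂ) * Complex.I with hc
  set r : ℝ := √5 * b with hr
  set R : ℝ := 249 / 100 * b with hR
  have h5 : (0 : ℝ) < √5 := by positivity
  have hrpos : 0 < r := by positivity
  have hRpos : 0 < R := by positivity
  have hrabs : |r| = r := abs_of_pos hrpos
  have hRabs : |R| = R := abs_of_pos hRpos
  have hrR : r < R := by
    have : √5 < 249 / 100 := by
      rw [Real.sqrt_lt' (by norm_num)]; norm_num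
    exact mul_lt_mul_of_pos_right this hb
  have hball : Metric.closedBall c R ⊆ {k : ℂ | -(2 * k.im) < a} := by
    intro k hk
    rw [mem_closedBall_iff_norm] at hk
    have h1 := (Complex.abs_im_le_norm _).trans hk
    have h3 : (k - c).im = k.im - 2 * b := by simp [hc]
    rw [h3] at h1
    change -(2 * k.im) < a
    linarith [neg_abs_le (k.im - 2 * b)]
  have han : AnalyticOnNhd ℂ (jostFunction V) (Metric.closedBall c R) :=
    h.analyticOnNhd_jostFunction.mono hball
  have hanr : AnalyticOnNhd ℂ (jostFunction V) (Metric.closedBall c r) :=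
    han.mono (Metric.closedBall_subset_closedBall hrR.le)
  have hhalf : 1 / 2 ≤ ‖jostFunction V c‖ := h.half_le_norm_jostFunction hb hbV
  have hc0 : jostFunction V c ≠ 0 := norm_pos_iff.1 (by linarith)
  set M : ℝ := expTail V b 0 with hM
  have hM0 : 0 ≤ M := expTail_nonneg V b 0
  have hJ := AnalyticOnNhd.sum_divisor_le (c := c) (r := r) (R := R)
    (M := Real.exp (M / (49 / 100 * b))) (f := jostFunction V) (by rwa [hrabs])
    (by rwa [hrabs, hRabs]) (Real.one_le_exp (by positivity)) (by rwa [hRabs]) hc0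
    (by rw [hRabs]; exact fun z hz => h.norm_jostFunction_le_on_sphere hb hba hz)
  rw [hrabs] at hJ
  set D := MeromorphicOn.divisor (jostFunction V) (Metric.closedBall c r) with hD
  have hD0 : ∀ k, 0 ≤ D k := fun k => MeromorphicOn.AnalyticOnNhd.divisor_nonneg hanr k
  have hfin := D.finiteSupport (isCompact_closedBall c r)
  have hupper : ∀ k, upperOrder V k ≤ ENNReal.ofReal (D k : ℝ) := by
    intro k
    rw [upperOrder]
    split_ifs with hk
    swap
    · exact zero_le
    rcases eq_or_ne (analyticOrderAt (jostFunction V) k) 0 with h0 | h0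
    · simp [h0]
    have hzero := apply_eq_zero_of_analyticOrderAt_ne_zero h0
    have hkb := h.norm_le_of_jostFunction_eq_zero hb hbV hk hzero
    have hmem : k ∈ Metric.closedBall c r := by
      rw [mem_closedBall_iff_norm]
      refine le_of_sq_le_sq ?_ hrpos.le
      -- For `|k| ≤ b` and `Im k ≥ 0` this is at most `5b²`, whence the inner radius `√5 b`.
      have e1 : ‖k - c‖ ^ 2 = ‖k‖ ^ 2 - 4 * b * k.im + 4 * b ^ 2 := by
        rw [← Complex.normSq_eq_norm_sq, ← Complex.normSq_eq_norm_sq, Complex.normSq_apply,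
          Complex.normSq_apply]
        simp [hc]
        ring
      rw [e1, hr, mul_pow, Real.sq_sqrt (by norm_num)]
      nlinarith [mul_nonneg hb.le hk, norm_nonneg k]
    -- An infinite order would make the function vanish identically on the disc, but it is nonzero
    -- at the centre.
    have hne : analyticOrderAt (jostFunction V) k ≠ ⊤ := by
      refine hanr.analyticOrderAt_ne_top_of_isPreconnected
        (convex_closedBall c r).isPreconnected (Metric.mem_closedBall_self hrpos.le) hmem ?_
      rw [(hanr c (Metric.mem_closedBall_self hrpos.le)).analyticOrderAt_eq_zero.2 hc0]
      exact ENat.zero_ne_top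
    rw [hD, MeromorphicOn.AnalyticOnNhd.divisor_apply hanr hmem]
    obtain ⟨m, hm⟩ := ENat.ne_top_iff_exists.1 hne
    rw [← hm]
    simp
  have hsum : ∑' k : ℂ, ENNReal.ofReal (D k : ℝ) = ENNReal.ofReal ((∑ᶠ k, D k : ℤ) : ℝ) := by
    rw [finsum_eq_sum_of_support_subset (s := hfin.toFinset) _ (by simp), Int.cast_sum,
      ENNReal.ofReal_sum_of_nonneg fun k _ => Int.cast_nonneg (hD0 k)]
    refine tsum_eq_sum fun k hk => ?_
    have : D k = 0 := by
      by_contra h0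
      exact hk (hfin.mem_toFinset.2 h0)
    simp [this]
  refine (ENNReal.tsum_le_tsum hupper).trans (hsum.le.trans (ENNReal.ofReal_le_ofReal ?_))
  refine hJ.trans ?_
  have hlog : 21 / 200 ≤ Real.log (R / r) := by
    rw [hR, hr, mul_div_mul_right _ _ hb.ne']
    exact log_radius_ratio_ge
  have hnum : Real.log (Real.exp (M / (49 / 100 * b)) / ‖jostFunction V c‖) ≤
      M / (49 / 100 * b) + 1 := by
    rw [Real.log_div (Real.exp_pos _).ne' (norm_ne_zero_iff.2 hc0), Real.log_exp]
    have h1 : Real.log (1 / 2) ≤ Real.log ‖jostFunction V c‖ := Real.log_le_log (by norm_num) hhalf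
    rw [one_div, Real.log_inv] at h1
    have h2 := Real.log_two_lt_d9
    linarith
  have hx : 0 ≤ M / b := by positivity
  have e1 : M / (49 / 100 * b) = 100 / 49 * (M / b) := by field_simp
  have e2 : 2 / b * M = 2 * (M / b) := by ring
  rw [e1] at hnum
  rw [div_le_iff₀ (by linarith), e1, e2]
  refine hnum.trans ?_
  -- The slack is `10 · 0.105 = 1.05 ≥ 1` and `20 · 0.105 = 2.1 ≥ 100/49`.
  calc 100 / 49 * (M / b) + 1 ≤ 10 * (1 + 2 * (M / b)) * (21 / 200) := by linarith
    _ ≤ _ := by gcongr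

theorem totalMultiplicity_eq_zero (hV : ∀ᵐ x ∂(volume.restrict (Ioi (0 : ℝ))), V x = 0) :
    totalMultiplicity V = 0 := by
  -- Any positive exponent serves, since `V` vanishes almost everywhere.
  have h : ExpDecay V 1 := by
    refine ⟨one_pos, (integrable_zero ℝ ℂ _).congr ?_⟩
    filter_upwards [hV] with x hx
    simp [hx]
  have htail : expTail V 1 0 = 0 := by
    rw [expTail]
    refine integral_eq_zero_of_ae ?_
    filter_upwards [hV] with x hx
    simp [hx]
  refine le_antisymm (h.totalMultiplicity_le_tsum.trans (le_of_eq ?_)) (zero_le)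
  refine ENNReal.tsum_eq_zero.2 fun k => ?_
  rw [upperOrder]
  split_ifs with hk
  swap
  · rfl
  have h1 := (h.kernelBound hk).norm_jostAmplitude_sub_one_le le_rfl
  rw [htail, mul_zero, Real.exp_zero, sub_self, ← jostFunction_eq] at h1
  have h2 : jostFunction V k = 1 := sub_eq_zero.1 (norm_le_zero_iff.1 h1)
  rw [analyticOrderAt_eq_zero.2 (Or.inr (by rw [h2]; exact one_ne_zero))]
  simp

end

end HalfLineSchrodinger

theorem corollary2 (V : ℝ → ℂ) (a b : ℝ)
    (hV : MeasureTheory.IntegrableOn (fun x : ℝ => (Real.exp (a * x) : ℂ) * V x) (Set.Ioi 0))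
    (hb : b = (1 / Real.log 2) * ∫ x in Set.Ioi (0 : ℝ), ‖V x‖)
    (hab : b ≤ a) :
    HalfLineSchrodinger.totalMultiplicity V ≤
      ENNReal.ofReal
        (10 * (1 + (2 / b) * ∫ x in Set.Ioi (0 : ℝ), Real.exp (b * x) * ‖V x‖)) := by
  have hlog : 0 < Real.log 2 := Real.log_pos (by norm_num)
  have hI : 0 ≤ ∫ x in Set.Ioi (0 : ℝ), ‖V x‖ :=
    MeasureTheory.integral_nonneg fun _ => norm_nonneg _
  have hbV : ∫ x in Set.Ioi (0 : ℝ), ‖V x‖ = b * Real.log 2 := by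
    rw [hb]; field_simp
  have hb0 : 0 ≤ b := by rw [hb]; positivity
  rcases hb0.lt_or_eq with hbpos | hbz
  · have h : HalfLineSchrodinger.ExpDecay V a := ⟨hbpos.trans_le hab, hV⟩
    exact h.totalMultiplicity_le_tsum.trans (h.tsum_upperOrder_le hbpos hab hbV)
  -- For `b = 0` the exponent `a` may be zero and `ExpDecay` unavailable, but then `V = 0` almost
  -- everywhere and the left side vanishes.
  · have hVi : MeasureTheory.IntegrableOn V (Set.Ioi 0) := by
      simpa using HalfLineSchrodinger.integrableOn_exp_mul_of_le (σ := 0) (hb0.trans hab) hV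
    rw [← hbz, zero_mul, MeasureTheory.integral_eq_zero_iff_of_nonneg
      (fun _ => norm_nonneg _) hVi.norm] at hbV
    rw [HalfLineSchrodinger.totalMultiplicity_eq_zero
      (hbV.mono fun x hx => norm_eq_zero.1 hx)]
    exact zero_le
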